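/- **Setting.** Let $\Omega\subset\mathbb R^d$ be bounded and open, $T>0$, $\hat p\in[1,\infty)$. Let $X,U_0$ be reflexive real Banach spaces and $H,V,\tilde V,W,Y$ separable reflexive real Banach spaces with continuous embeddings $$U_0\hookrightarrow H\hookrightarrow W,\quad V\hookrightarrow H\hookrightarrow\tilde V,\quad V\hookrightarrow Y,\quad V\hookrightarrow L^{\hat p}(\Omega)\hookrightarrow W,$$ where $V\hookrightarrow L^{\hat p}(\Omega)$ is compact and either $L^{\hat p}(\Omega)\hookrightarrow\tilde V$ or $\tilde V\hookrightarrow L^{\hat p}(\Omega)$ (embeddings that represent the same inclusion agree). Put $\mathcal V=L^2(0,T;V)\cap H^1(0,T;\tilde V)$ with norm $\big(\int_0^T\|u\|_V^2+\|\dot u\|_{\tilde V}^2\,dt\big)^{1/2}$, $\mathcal W=L^2(0,T;W)$, $\mathcal Y=L^2(0,T;Y)$, and assume $\mathcal V\hookrightarrow L^\infty((0,T)\times\Omega)$ and $\mathcal V\hookrightarrow C([0,T];H)$. Let $M:\mathcal V\to\mathcal Y$ be bounded and linear. Let $F:(0,T)\times X\times V\to W$ be such that, for every $\lambda\in X$,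 $F(\cdot,\lambda,v)$ is measurable for all $v\in V$ and $F(t,\lambda,\cdot)$ is continuous for a.e. $t$, and such that for a.e. $t$ and all $\lambda\in X$, $v\in V$ $$\|F(t,\lambda,v)\|_W\le\mathcal B(\|\lambda\|_X,\|v\|_H)\,(\gamma(t)+\|v\|_V)$$ for some $\gamma\in L^2(0,T)$ and some $\mathcal B:\mathbb R^2\to\mathbb R$ that is nondecreasing in its second argument. Fix a depth $L$ and widths $n_0=m+1,n_1,\dots,n_{L-1},n_L=1$, let $\sigma:\mathbb R\to\mathbb R$ be continuous, and let $\Theta$ be the finite-dimensional space of parameters $\theta=(\omega^l,\beta^l)_{l=1}^L$. Let $\mathcal N_\theta:\mathbb R^m\times\mathbb R\to\mathbb R$ be the feed-forward network with layers $z\mapsto\sigma(\omega^lz+\beta^l)$ ($\sigma$ componentwise) for $l<L$ and $z\mapsto\omega^Lz+\beta^L$ for $l=L$. Weak continuity, weak-to-strong continuity and weak closedness are meant sequentially; a map $G$ between normed spaces is *weakly closed* if $x_n\rightharpoonup x$ and $G(x_n)\rightharpoonup g$ imply $G(x)=g$. **Lemma.** 0. The Nemytskii operators $F:X\times\mathcal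 V\to\mathcal W$, $F(\lambda,u)(t)=F(t,\lambda,u(t))$, and $\mathcal N:\mathbb R^m\times\mathcal V\times\Theta\to L^2(0,T;L^{\hat p}(\Omega))\hookrightarrow\mathcal W$, $\mathcal N(\alpha,u,\theta)(t)(x)=\mathcal N_\theta(\alpha,u(t,x))$, are well defined. 1. If $\sigma$ is locally Lipschitz, then $\mathcal N:\mathbb R^m\times\mathcal V\times\Theta\to\mathcal W$ is weak-to-strong continuous; in particular it is weakly continuous. 2. $F:X\times\mathcal V\to\mathcal W$ is weakly closed if one of the following holds: * (a) for a.e. $t\in(0,T)$, $F(t,\cdot)$ is the restriction to $X\times V$ of a weakly continuous map $X\times H\to W$; or * (b) $V$ is compactly embedded in $H$, there is a continuous embedding $H\hookrightarrow W^*$, and $-F$ is pseudomonotone in the following sense: for a.e. $t\in(0,T)$ and all $v_k,v\in V$ and $\lambda_k,\lambda\in X$ with $(v_k,\lambda_k)\rightharpoonup(v,\lambda)$ in $H\times X$ and $\liminf_k\langle F(t,\lambda_k,v_k),v_k-v\rangle_{W,W^*}\ge0$, one has $\langle F(t,\lambda,v),v-w\rangle_{W,W^*}\ge\limsup_k\langle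 F(t,\lambda_k,v_k),v_k-w\rangle_{W,W^*}$ for all $w\in W^*$. 3. Suppose that $\dot u\in\mathcal W$ for all $u\in\mathcal V$ (so that $\mathcal G$ below is defined). If $\mathcal N$ is weakly continuous and $F$ is weakly closed, then the all-at-once forward operator $$\mathcal G:X\times\mathbb R^m\times U_0\times\mathcal V\times\Theta\to\mathcal W\times H\times\mathcal Y,\quad \mathcal G(\lambda,\alpha,u_0,u,\theta)=\big(\dot u-F(\lambda,u)-\mathcal N(\alpha,u,\theta),\,u(0)-u_0,\,Mu\big)$$ is weakly closed. -/

import Mathlib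

open MeasureTheory Filter Topology Set
open scoped ENNReal ContDiff

noncomputable section

/-! ### Weak convergence and weak closedness -/

/-- Weak convergence `x n ⇀ a` of a sequence in a normed space. -/
def WeakConv {E : Type*} [NormedAddCommGroup E] [NormedSpace ℝ E] (x : ℕ → E) (a : E) : Prop :=
  ∀ f : StrongDual ℝ E, Tendsto (fun n => f (x n)) atTop (𝓝 (f a))

/-- Weak(-to-weak) continuity: `x n ⇀ a` implies `f (x n) ⇀ f a`. -/
def WeakContinuous {E G : Type*} [NormedAddCommGroup E] [NormedSpace ℝ E]
    [NormedAddCommGroup G] [NormedSpace ℝ G] (f : E → G) : Prop :=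
  ∀ (x : ℕ → E) (a : E), WeakConv x a → WeakConv (fun n => f (x n)) (f a)

/-- Weak-to-strong continuity: `x n ⇀ a` implies `f (x n) → f a` in norm. -/
def WeakToStrongContinuous {E G : Type*} [NormedAddCommGroup E] [NormedSpace ℝ E]
    [NormedAddCommGroup G] (f : E → G) : Prop :=
  ∀ (x : ℕ → E) (a : E), WeakConv x a → Tendsto (fun n => f (x n)) atTop (𝓝 (f a))

/-- Weak closedness: `x n ⇀ a` and `f (x n) ⇀ b` imply `f a = b`. -/
def WeaklyClosed {E G : Type*} [NormedAddCommGroup E] [NormedSpace ℝ E]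
    [NormedAddCommGroup G] [NormedSpace ℝ G] (f : E → G) : Prop :=
  ∀ (x : ℕ → E) (a : E) (b : G), WeakConv x a → WeakConv (fun n => f (x n)) b → f a = b

/-- Reflexivity: the canonical map into the bidual is onto. -/
def IsReflexive (E : Type*) [NormedAddCommGroup E] [NormedSpace ℝ E] : Prop :=
  Function.Surjective (NormedSpace.inclusionInDoubleDual ℝ E)

/-! ### Time-dependent function spaces -/

/-- Lebesgue measure on `(0, T)`; the Bochner space `L²(0,T;E)` is `Lp E 2 (timeMeasure T)`. -/
abbrev timeMeasure (T : ℝ) : Measure ℝ := volume.restrict (Ioo 0 T)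

/-- `g` is the weak time derivative of `f` on `(0, T)`. -/
def IsWeakDeriv {E : Type*} [NormedAddCommGroup E] [NormedSpace ℝ E]
    (T : ℝ) (f g : ℝ → E) : Prop :=
  ∀ φ : ℝ → ℝ, ContDiff ℝ ∞ φ → HasCompactSupport φ → tsupport φ ⊆ Ioo 0 T →
    ∫ t in Ioo 0 T, deriv φ t • f t = - ∫ t in Ioo 0 T, φ t • g t

theorem integrable_smul_of_Lp {E : Type*} [NormedAddCommGroup E] [NormedSpace ℝ E] {T : ℝ}
    {φ : ℝ → ℝ} (hc : Continuous φ) (hs : HasCompactSupport φ) {f : ℝ → E}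
    (hf : MemLp f 2 (timeMeasure T)) : Integrable (fun t => φ t • f t) (timeMeasure T) := by
  have hi : Integrable f (timeMeasure T) := hf.integrable (by norm_num)
  obtain ⟨C, hC⟩ := hc.bounded_above_of_compact_support hs
  exact hi.bdd_smul C hc.aestronglyMeasurable (Eventually.of_forall hC)

/-- For `ι : V → Z`, the space `{u ∈ L²(0,T;V) : (ι ∘ u)˙ ∈ L²(0,T;Z)}`, i.e.
`L²(0,T;V) ∩ H¹(0,T;Z)`. An element is stored as the pair `(u, u̇)`, in which `u̇` is determined
by `u`; the norm is `(‖u‖² + ‖u̇‖²)^(1/2)`. -/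
def sobolevBochner {V Z : Type*} [NormedAddCommGroup V] [NormedSpace ℝ V]
    [NormedAddCommGroup Z] [NormedSpace ℝ Z] (T : ℝ) (ι : V →L[ℝ] Z) :
    Submodule ℝ (WithLp 2 (Lp V 2 (timeMeasure T) × Lp Z 2 (timeMeasure T))) where
  carrier := {u | IsWeakDeriv T (fun t => ι (u.fst t)) (fun t => u.snd t)}
  zero_mem' := by
    intro φ _ _ _
    have h1 : ∀ᵐ t ∂(timeMeasure T), deriv φ t •
        ι ((0 : WithLp 2 (Lp V 2 (timeMeasure T) × Lp Z 2 (timeMeasure T))).fst t) = 0 := by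
      filter_upwards [Lp.coeFn_zero V 2 (timeMeasure T)] with t ht
      change deriv φ t • ι ((0 : Lp V 2 (timeMeasure T)) t) = 0
      rw [ht, Pi.zero_apply, map_zero, smul_zero]
    have h2 : ∀ᵐ t ∂(timeMeasure T), φ t •
        (0 : WithLp 2 (Lp V 2 (timeMeasure T) × Lp Z 2 (timeMeasure T))).snd t = 0 := by
      filter_upwards [Lp.coeFn_zero Z 2 (timeMeasure T)] with t ht
      change φ t • (0 : Lp Z 2 (timeMeasure T)) t = 0
      rw [ht, Pi.zero_apply, smul_zero]
    rw [integral_congr_ae h1, integral_congr_ae h2]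
    simp
  add_mem' := by
    intro u v hu hv φ h1 h2 h3
    have hd : Continuous (deriv φ) := h1.continuous_deriv (by simp)
    have mu : MemLp (fun t => ι (u.fst t)) 2 (timeMeasure T) := ι.comp_memLp' (Lp.memLp u.fst)
    have mv : MemLp (fun t => ι (v.fst t)) 2 (timeMeasure T) := ι.comp_memLp' (Lp.memLp v.fst)
    have e1 : ∀ᵐ t ∂(timeMeasure T), deriv φ t • ι ((u + v).fst t) =
        deriv φ t • ι (u.fst t) + deriv φ t • ι (v.fst t) := by
      filter_upwards [Lp.coeFn_add u.fst v.fst] with t ht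
      change deriv φ t • ι ((u.fst + v.fst : Lp V 2 (timeMeasure T)) t) = _
      rw [ht, Pi.add_apply, map_add, smul_add]
    have e2 : ∀ᵐ t ∂(timeMeasure T), φ t • (u + v).snd t =
        φ t • u.snd t + φ t • v.snd t := by
      filter_upwards [Lp.coeFn_add u.snd v.snd] with t ht
      change φ t • (u.snd + v.snd : Lp Z 2 (timeMeasure T)) t = _
      rw [ht, Pi.add_apply, smul_add]
    rw [integral_congr_ae e1, integral_congr_ae e2,
      integral_add (integrable_smul_of_Lp hd h2.deriv mu) (integrable_smul_of_Lp hd h2.deriv mv),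
      integral_add (integrable_smul_of_Lp h1.continuous h2 (Lp.memLp u.snd))
        (integrable_smul_of_Lp h1.continuous h2 (Lp.memLp v.snd)), hu φ h1 h2 h3, hv φ h1 h2 h3]
    abel
  smul_mem' := by
    intro c u hu φ h1 h2 h3
    have e1 : ∀ᵐ t ∂(timeMeasure T), deriv φ t • ι ((c • u).fst t) =
        c • (deriv φ t • ι (u.fst t)) := by
      filter_upwards [Lp.coeFn_smul c u.fst] with t ht
      simp [ht, smul_comm c]
    have e2 : ∀ᵐ t ∂(timeMeasure T), φ t • (c • u).snd t = c • (φ t • u.snd t) := by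
      filter_upwards [Lp.coeFn_smul c u.snd] with t ht
      simp [ht, smul_comm c]
    rw [integral_congr_ae e1, integral_congr_ae e2, integral_smul, integral_smul, hu φ h1 h2 h3]
    simp

/-! ### Neural networks -/

/-- The parameter space `Θ` of a network of depth `L` with widths `n 0, …, n L`: a matrix and a
bias for each layer. -/
abbrev NetParam (L : ℕ) (n : ℕ → ℕ) : Type :=
  (l : Fin L) → ((Fin (n l) → ℝ) →L[ℝ] (Fin (n (l + 1)) → ℝ)) × (Fin (n (l + 1)) → ℝ)

/-- The composition of the first `l` layers. Layers `1, …, L - 1` apply `σ` componentwise to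
`ω z + β`; the last layer is affine. -/
def netLayers (σ : ℝ → ℝ) {L : ℕ} {n : ℕ → ℕ} (θ : NetParam L n) (x : Fin (n 0) → ℝ) :
    (l : ℕ) → l ≤ L → (Fin (n l) → ℝ)
  | 0, _ => x
  | l + 1, h =>
    let z := (θ ⟨l, h⟩).1 (netLayers σ θ x l (Nat.le_of_succ_le h)) + (θ ⟨l, h⟩).2
    fun i => if l + 1 = L then z i else σ (z i)

/-- The network as a function `(α, y) ↦ 𝒩_θ(α, y)` on `ℝᵐ × ℝ`, for `n 0 = m + 1`, `n L = 1`. -/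
def net (σ : ℝ → ℝ) {L m : ℕ} {n : ℕ → ℕ} (h0 : n 0 = m + 1) (hL : n L = 1)
    (θ : NetParam L n) (α : Fin m → ℝ) (y : ℝ) : ℝ :=
  netLayers σ θ (fun i => (Fin.snoc α y : Fin (m + 1) → ℝ) (Fin.cast h0 i)) L le_rfl
    (Fin.cast hL.symm 0)

/-! ### The abstract setting -/

/-- The spaces, embeddings, model function and observation operator. An embedding `A ↪ B` is an
injective bounded linear map; embeddings that represent the same inclusion agree. -/
structure Setting {d : ℕ} (Ω : Set (EuclideanSpace ℝ (Fin d))) (T : ℝ) (p : ℝ≥0∞) [Fact (1 ≤ p)]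
    (X U₀ H V Vt W Y : Type*)
    [NormedAddCommGroup X] [NormedSpace ℝ X] [NormedAddCommGroup U₀] [NormedSpace ℝ U₀]
    [NormedAddCommGroup H] [NormedSpace ℝ H] [NormedAddCommGroup V] [NormedSpace ℝ V]
    [NormedAddCommGroup Vt] [NormedSpace ℝ Vt] [NormedAddCommGroup W] [NormedSpace ℝ W]
    [NormedAddCommGroup Y] [NormedSpace ℝ Y] where
  /-- `U₀ ↪ H` -/
  iU₀H : U₀ →L[ℝ] H
  iU₀H_inj : Function.Injective iU₀H
  /-- `H ↪ W` -/
  iHW : H →L[ℝ] W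
  iHW_inj : Function.Injective iHW
  /-- `V ↪ H` -/
  iVH : V →L[ℝ] H
  iVH_inj : Function.Injective iVH
  /-- `H ↪ Ṽ` -/
  iHVt : H →L[ℝ] Vt
  iHVt_inj : Function.Injective iHVt
  /-- `V ↪ Y` -/
  iVY : V →L[ℝ] Y
  iVY_inj : Function.Injective iVY
  /-- `V ↪ L^p(Ω)`, compactly -/
  iVL : V →L[ℝ] Lp ℝ p (volume.restrict Ω)
  iVL_inj : Function.Injective iVL
  iVL_compact : IsCompactOperator iVL
  /-- `L^p(Ω) ↪ W` -/
  iLW : Lp ℝ p (volume.restrict Ω) →L[ℝ] W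
  iLW_inj : Function.Injective iLW
  /-- the inclusions `V ⊆ H ⊆ W` and `V ⊆ L^p(Ω) ⊆ W` agree -/
  iVW_comm : ∀ v, iLW (iVL v) = iHW (iVH v)
  /-- `L^p(Ω) ↪ Ṽ` or `Ṽ ↪ L^p(Ω)` -/
  LVt_or_VtL :
    (∃ j : Lp ℝ p (volume.restrict Ω) →L[ℝ] Vt, Function.Injective j ∧
      ∀ v, j (iVL v) = iHVt (iVH v)) ∨
    (∃ j : Vt →L[ℝ] Lp ℝ p (volume.restrict Ω), Function.Injective j ∧
      ∀ v, j (iHVt (iVH v)) = iVL v)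
  /-- `𝒱 ↪ L^∞((0,T) × Ω)` -/
  embLinfty : sobolevBochner T (iHVt.comp iVH) →L[ℝ]
    Lp ℝ ⊤ ((timeMeasure T).prod (volume.restrict Ω))
  embLinfty_spec : ∀ u, ∀ᵐ t ∂(timeMeasure T), ∀ᵐ x ∂(volume.restrict Ω),
    embLinfty u (t, x) = iVL (u.1.fst t) x
  /-- `𝒱 ↪ C([0,T];H)` -/
  embC : sobolevBochner T (iHVt.comp iVH) →L[ℝ] C(Icc (0 : ℝ) T, H)
  embC_spec : ∀ u, ∀ᵐ t ∂(timeMeasure T), ∀ ht : t ∈ Icc (0 : ℝ) T,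
    embC u ⟨t, ht⟩ = iVH (u.1.fst t)
  /-- the model function `F : (0,T) × X × V → W` (values for `t ∉ (0,T)` play no role) -/
  F : ℝ → X → V → W
  F_measurable : ∀ lam v, AEStronglyMeasurable (fun t => F t lam v) (timeMeasure T)
  F_continuous : ∀ lam, ∀ᵐ t ∂(timeMeasure T), Continuous (F t lam)
  F_growth : ∃ (B : ℝ → ℝ → ℝ) (γ : ℝ → ℝ), (∀ a, Monotone (B a)) ∧ MemLp γ 2 (timeMeasure T) ∧
    ∀ᵐ t ∂(timeMeasure T), ∀ lam v, ‖F t lam v‖ ≤ B ‖lam‖ ‖iVH v‖ * (γ t + ‖v‖)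
  /-- the observation operator `M ∈ ℒ(𝒱, 𝒴)`, `𝒴 = L²(0,T;Y)` -/
  M : sobolevBochner T (iHVt.comp iVH) →L[ℝ] Lp Y 2 (timeMeasure T)

namespace Setting

variable {d : ℕ} {Ω : Set (EuclideanSpace ℝ (Fin d))} {T : ℝ} {p : ℝ≥0∞} [Fact (1 ≤ p)]
  {X U₀ H V Vt W Y : Type*}
  [NormedAddCommGroup X] [NormedSpace ℝ X] [NormedAddCommGroup U₀] [NormedSpace ℝ U₀]
  [NormedAddCommGroup H] [NormedSpace ℝ H] [NormedAddCommGroup V] [NormedSpace ℝ V]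
  [NormedAddCommGroup Vt] [NormedSpace ℝ Vt] [NormedAddCommGroup W] [NormedSpace ℝ W]
  [NormedAddCommGroup Y] [NormedSpace ℝ Y]

/-- The state space `𝒱 = L²(0,T;V) ∩ H¹(0,T;Ṽ)`. -/
abbrev 𝒱 (S : Setting Ω T p X U₀ H V Vt W Y) :
    Submodule ℝ (WithLp 2 (Lp V 2 (timeMeasure T) × Lp Vt 2 (timeMeasure T))) :=
  sobolevBochner T (S.iHVt.comp S.iVH)

/-- The values `u(t) ∈ V` of a state `u ∈ 𝒱`, for almost every `t`. -/
def val (S : Setting Ω T p X U₀ H V Vt W Y) (u : S.𝒱) (t : ℝ) : V := u.1.fst t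

/-- The Nemytskii operator of `F` is well defined at `(λ, u)`: `t ↦ F(t, λ, u(t))` is
in `𝒲 = L²(0,T;W)`. -/
def FWellDefined (S : Setting Ω T p X U₀ H V Vt W Y) (lam : X) (u : S.𝒱) : Prop :=
  MemLp (fun t => S.F t lam (S.val u t)) 2 (timeMeasure T)

open Classical in
/-- The Nemytskii operator `F : X × 𝒱 → 𝒲`, `F(λ,u)(t) = F(t, λ, u(t))`. -/
def nemF (S : Setting Ω T p X U₀ H V Vt W Y) (x : X × S.𝒱) : Lp W 2 (timeMeasure T) :=
  if h : S.FWellDefined x.1 x.2 then MemLp.toLp _ h else 0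

open Classical in
/-- The superposition of a scalar function `f` with `l ∈ L^p(Ω)`, as an element of `L^p(Ω)`. -/
def superpose (Ω : Set (EuclideanSpace ℝ (Fin d))) (p : ℝ≥0∞) (f : ℝ → ℝ)
    (l : Lp ℝ p (volume.restrict Ω)) : Lp ℝ p (volume.restrict Ω) :=
  if h : MemLp (fun x => f (l x)) p (volume.restrict Ω) then MemLp.toLp _ h else 0

/-- The Nemytskii operator of `f : ℝ → ℝ` is well defined at `u ∈ 𝒱`: for a.e. `t` the function
`x ↦ f(u(t,x))` is in `L^p(Ω)`, and as a function of `t` it is in `L²(0,T;L^p(Ω))`. -/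
def NetWellDefined (S : Setting Ω T p X U₀ H V Vt W Y) (f : ℝ → ℝ) (u : S.𝒱) : Prop :=
  (∀ᵐ t ∂(timeMeasure T), MemLp (fun x => f (S.iVL (S.val u t) x)) p (volume.restrict Ω)) ∧
    MemLp (fun t => superpose Ω p f (S.iVL (S.val u t))) 2 (timeMeasure T)

open Classical in
/-- The network Nemytskii operator `(α, u, θ) ↦ 𝒩_θ(α, u) ∈ 𝒲`, with
`𝒩_θ(α, u)(t)(x) = 𝒩_θ(α, u(t,x))`, taken in `L²(0,T;L^p(Ω))` and mapped
to `𝒲` by `L^p(Ω) ↪ W`. -/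
def nemN (S : Setting Ω T p X U₀ H V Vt W Y) (σ : ℝ → ℝ) {L m : ℕ} {n : ℕ → ℕ}
    (h0 : n 0 = m + 1) (hL : n L = 1) (x : (Fin m → ℝ) × S.𝒱 × NetParam L n) :
    Lp W 2 (timeMeasure T) :=
  if h : S.NetWellDefined (net σ h0 hL x.2.2 x.1) x.2.1 then
    S.iLW.compLp (MemLp.toLp _ h.2) else 0

/-- `u̇ ∈ 𝒲`: the state `u`, as a `W`-valued function, has a weak derivative in `𝒲`. -/
def DerivInW (S : Setting Ω T p X U₀ H V Vt W Y) (u : S.𝒱) : Prop :=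
  ∃ g : Lp W 2 (timeMeasure T),
    IsWeakDeriv T (fun t => S.iHW (S.iVH (S.val u t))) (fun t => g t)

open Classical in
/-- The time derivative `u̇ ∈ 𝒲`. -/
def timeDeriv (S : Setting Ω T p X U₀ H V Vt W Y) (u : S.𝒱) : Lp W 2 (timeMeasure T) :=
  if h : S.DerivInW u then h.choose else 0

/-- The initial trace `u(0) ∈ H`. -/
def trace0 (S : Setting Ω T p X U₀ H V Vt W Y) (hT : 0 < T) (u : S.𝒱) : H :=
  S.embC u ⟨0, le_rfl, hT.le⟩

/-- The all-at-once forward operator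
`𝒢(λ, α, u₀, u, θ) = (u̇ - F(λ,u) - 𝒩_θ(α,u), u(0) - u₀, M u)`. -/
def forward (S : Setting Ω T p X U₀ H V Vt W Y) (hT : 0 < T) (σ : ℝ → ℝ) {L m : ℕ} {n : ℕ → ℕ}
    (h0 : n 0 = m + 1) (hL : n L = 1) (x : X × (Fin m → ℝ) × U₀ × S.𝒱 × NetParam L n) :
    Lp W 2 (timeMeasure T) × H × Lp Y 2 (timeMeasure T) :=
  match x with
  | (lam, α, u₀, u, θ) =>
    (S.timeDeriv u - S.nemF (lam, u) - S.nemN σ h0 hL (α, u, θ), S.trace0 hT u - S.iU₀H u₀, S.M u)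

/-- For a.e. `t`, `F(t,·)` is (the restriction to `X × V` of) a weakly continuous map
`X × H → W`. -/
def FWeaklyContinuous (S : Setting Ω T p X U₀ H V Vt W Y) : Prop :=
  ∃ FH : ℝ → X × H → W, ∀ᵐ t ∂(timeMeasure T),
    (∀ lam v, FH t (lam, S.iVH v) = S.F t lam v) ∧ WeakContinuous (FH t)

/-- `-F` is pseudomonotone with respect to the embedding `j : H ↪ W*`: for a.e. `t`, if
`(v k, λ k) ⇀ (v, λ)` in `H × X` and `liminf ⟨F(t, λ k, v k), v k - v⟩ ≥ 0`, then
`⟨F(t, λ, v), v - w⟩ ≥ limsup ⟨F(t, λ k, v k), v k - w⟩` for all `w ∈ W*`. Upper and lower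
limits are taken in the extended reals. -/
def NegFPseudomonotone (S : Setting Ω T p X U₀ H V Vt W Y) (j : H →L[ℝ] StrongDual ℝ W) : Prop :=
  ∀ᵐ t ∂(timeMeasure T), ∀ (v : ℕ → V) (v' : V) (lam : ℕ → X) (lam' : X),
    WeakConv (fun k => (S.iVH (v k), lam k)) (S.iVH v', lam') →
    0 ≤ liminf (fun k =>
      (((j (S.iVH (v k)) - j (S.iVH v')) (S.F t (lam k) (v k)) : ℝ) : EReal)) atTop →
    ∀ w : StrongDual ℝ W,
      limsup (fun k => (((j (S.iVH (v k)) - w) (S.F t (lam k) (v k)) : ℝ) : EReal)) atTop ≤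
        (((j (S.iVH v') - w) (S.F t lam' v') : ℝ) : EReal)

end Setting

end

/-! Three features of a weakly convergent sequence `u n ⇀ u'` in `𝒱` carry the proof. It is bounded,
so the embedding into `L^∞` confines all its values to one interval. Evaluation at a time `t` is
bounded and linear from `𝒱` to `H`, so the values converge weakly in `H` at a.e. `t`
(`ae_weakConv_iVH_val`). A compact operator on `V` compatible with `V ⊆ H` turns this into norm
convergence in `L²` in time (`tendsto_eLpNorm_of_compact`): an Ehrling inequality leaves only a
small multiple of the `V`-norm and finitely many functionals of the `H`-values, which vanish by
bounded convergence. This takes the place of the Aubin–Lions lemma.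

For the network, the states thus converge in `L²(0,T;L^p(Ω))`, while `α` and `θ` converge in norm
because their spaces are finite-dimensional. Truncation makes the networks uniformly bounded, and
bounded convergence, in `x` and then in `t`, gives norm convergence.

For `F`, a weak `L²` limit agrees with an a.e. weak limit, so weak convergence of the values at a.e.
`t` along a subsequence suffices (`weaklyClosed_nemF_of_ae`). Under (a) this is immediate. Under (b)
compactness sends the pairing of `F` with `u n - u'` to zero, and pseudomonotonicity tested with `w
= u'(t) - z` for all `z` yields the weak limit.

For `𝒢`, the time derivative is bounded by the closed graph theorem. Every term except `F` is then
weakly continuous and can be moved to the other side (`weaklyClosed_forward`). -/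

/-! ### Weak convergence in normed spaces. -/

section WeakConvergence

variable {E G : Type*} [NormedAddCommGroup E] [NormedSpace ℝ E]
  [NormedAddCommGroup G] [NormedSpace ℝ G]

theorem WeakConv.map (f : E →L[ℝ] G) {x : ℕ → E} {a : E} (h : WeakConv x a) :
    WeakConv (fun n => f (x n)) (f a) :=
  fun φ => h (φ.comp f)

theorem WeakConv.comp_tendsto {x : ℕ → E} {a : E} (h : WeakConv x a) {k : ℕ → ℕ}
    (hk : Tendsto k atTop atTop) : WeakConv (fun n => x (k n)) a :=
  fun φ => (h φ).comp hk

theorem WeakConv.sub {x y : ℕ → E} {a b : E} (hx : WeakConv x a) (hy : WeakConv y b) :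
    WeakConv (fun n => x n - y n) (a - b) := by
  intro φ
  simpa only [map_sub] using (hx φ).sub (hy φ)

theorem WeakConv.prodMk {x : ℕ → E} {y : ℕ → G} {a : E} {b : G} (hx : WeakConv x a)
    (hy : WeakConv y b) : WeakConv (fun n => (x n, y n)) (a, b) := by
  intro φ
  have key : ∀ (u : E) (v : G), φ (u, v) =
      (φ.comp (ContinuousLinearMap.inl ℝ E G)) u + (φ.comp (ContinuousLinearMap.inr ℝ E G)) v := by
    intro u v
    simp [← map_add]
  simp only [key]
  exact (hx _).add (hy _)

theorem WeakConv.fst {x : ℕ → E × G} {a : E × G} (h : WeakConv x a) :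
    WeakConv (fun n => (x n).1) a.1 :=
  h.map (ContinuousLinearMap.fst ℝ E G)

theorem WeakConv.snd {x : ℕ → E × G} {a : E × G} (h : WeakConv x a) :
    WeakConv (fun n => (x n).2) a.2 :=
  h.map (ContinuousLinearMap.snd ℝ E G)

theorem Filter.Tendsto.weakConv {x : ℕ → E} {a : E} (h : Tendsto x atTop (𝓝 a)) : WeakConv x a :=
  fun φ => (φ.continuous.tendsto a).comp h

theorem WeakConv.unique {x : ℕ → E} {a b : E} (ha : WeakConv x a) (hb : WeakConv x b) : a = b := by
  refine (SeparatingDual.eq_iff_forall_dual_eq (R := ℝ)).2 fun φ => ?_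
  exact tendsto_nhds_unique (ha φ) (hb φ)

/-- Uniform boundedness, applied to the images of `x n` in the bidual: the dual is always complete
and the inclusion is isometric. -/
theorem WeakConv.bounded {x : ℕ → E} {a : E} (h : WeakConv x a) :
    ∃ C, 0 ≤ C ∧ ∀ n, ‖x n‖ ≤ C := by
  obtain ⟨C, hC⟩ := banach_steinhaus (g := fun n => NormedSpace.inclusionInDoubleDual ℝ E (x n))
    (fun φ => by
      obtain ⟨C, hC⟩ := (h φ).norm.bddAbove_range
      exact ⟨C, fun n => by simpa using hC ⟨n, rfl⟩⟩)
  refine ⟨C, (norm_nonneg _).trans (hC 0), fun n => ?_⟩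
  have := NormedSpace.inclusionInDoubleDualLi (E := E) ℝ |>.norm_map (x n)
  rw [← this]
  exact hC n

theorem WeakConv.tendsto_of_finiteDimensional [FiniteDimensional ℝ E] {x : ℕ → E} {a : E}
    (h : WeakConv x a) : Tendsto x atTop (𝓝 a) := by
  let e := ContinuousLinearEquiv.ofFinrankEq (𝕜 := ℝ) (E := E)
    (F := Fin (Module.finrank ℝ E) → ℝ) (by simp)
  have h1 : Tendsto (fun n => e (x n)) atTop (𝓝 (e a)) := by
    rw [tendsto_pi_nhds]
    intro i
    exact h ((ContinuousLinearMap.proj (R := ℝ) (φ := fun _ => ℝ) i).comp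
      (e : E →L[ℝ] (Fin (Module.finrank ℝ E) → ℝ)))
  simpa [Function.comp_def] using (e.symm.continuous.tendsto _).comp h1

theorem WeakToStrongContinuous.weakContinuous {f : E → G} (h : WeakToStrongContinuous f) :
    WeakContinuous f :=
  fun x a hx => (h x a hx).weakConv

end WeakConvergence

/-- A weak form of Ehrling's lemma. -/
theorem IsCompactOperator.exists_norm_le_add_sum {V Z G : Type*} [NormedAddCommGroup V]
    [NormedSpace ℝ V] [NormedAddCommGroup Z] [NormedSpace ℝ Z] [NormedAddCommGroup G]
    [NormedSpace ℝ G] {K : V →L[ℝ] Z} (hK : IsCompactOperator K) (i : Z →L[ℝ] G)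
    (hi : Function.Injective i) {ε : ℝ} (hε : 0 < ε) :
    ∃ s : Finset (StrongDual ℝ G), ∀ v, ‖K v‖ ≤ ε * ‖v‖ + ‖K‖ * ∑ φ ∈ s, |φ (i (K v))| := by
  have hc : IsCompact (closure (K '' Metric.closedBall 0 1)) :=
    hK.isCompact_closure_image_closedBall 1
  have hc' : IsCompact (closure (K '' Metric.closedBall 0 1) ∩ {z | ε ≤ ‖z‖}) :=
    hc.inter_right (isClosed_le continuous_const continuous_norm)
  -- The dual separates points and `i` is injective, so the sets `1 < |φ (i z)|` cover the part of
  -- the image away from `0`. The factor `2` below makes the inequality strict.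
  obtain ⟨s, hs⟩ := hc'.elim_finite_subcover
    (fun φ : StrongDual ℝ G => {z | 1 < |φ (i z)|})
    (fun φ => isOpen_lt continuous_const (by fun_prop)) (by
      rintro z ⟨-, hz⟩
      have hz0 : i z ≠ 0 := by
        intro h
        have : z = 0 := hi (by rw [h, map_zero])
        subst this
        exact absurd hz (by simpa using hε)
      obtain ⟨φ, hφ⟩ := SeparatingDual.exists_eq_one (R := ℝ) hz0
      refine mem_iUnion.2 ⟨(2 : ℝ) • φ, ?_⟩
      simp [hφ])
  refine ⟨s, ?_⟩
  have unit : ∀ v, ‖v‖ ≤ 1 → ‖K v‖ ≤ ε + ‖K‖ * ∑ φ ∈ s, |φ (i (K v))| := by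
    intro v hv
    by_cases h : ε ≤ ‖K v‖
    · obtain ⟨φ, hφs, hφ⟩ := mem_iUnion₂.1 (hs ⟨subset_closure ⟨v, by simpa using hv, rfl⟩, h⟩)
      have h1 : 1 ≤ ∑ φ ∈ s, |φ (i (K v))| :=
        (le_of_lt hφ).trans (Finset.single_le_sum (f := fun φ : StrongDual ℝ G => |φ (i (K v))|)
          (fun _ _ => abs_nonneg _) hφs)
      have h2 : ‖K v‖ ≤ ‖K‖ := by
        simpa using (K.le_opNorm v).trans (mul_le_mul_of_nonneg_left hv (norm_nonneg K))
      nlinarith [norm_nonneg K]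
    · push Not at h
      have : 0 ≤ ‖K‖ * ∑ φ ∈ s, |φ (i (K v))| := by positivity
      linarith
  -- Both sides are positively homogeneous, so the bound on the unit ball suffices.
  intro v
  rcases eq_or_ne v 0 with rfl | hv
  · simp
  · have hv' : 0 < ‖v‖ := norm_pos_iff.2 hv
    have h := unit (‖v‖⁻¹ • v) (by rw [norm_smul, norm_inv, norm_norm, inv_mul_cancel₀ hv'.ne'])
    simp only [map_smul, norm_smul, norm_inv, norm_norm, smul_eq_mul, abs_mul, abs_inv,
      abs_norm, ← Finset.mul_sum] at h
    have h2 := mul_le_mul_of_nonneg_left h hv'.le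
    have e1 : ‖v‖ * (‖v‖⁻¹ * ‖K v‖) = ‖K v‖ := by field_simp
    have e2 : ‖v‖ * (ε + ‖K‖ * (‖v‖⁻¹ * ∑ φ ∈ s, |φ (i (K v))|)) =
        ε * ‖v‖ + ‖K‖ * ∑ φ ∈ s, |φ (i (K v))| := by field_simp
    rwa [e1, e2] at h2

/-! ### Uniform integrability, convergence in `L^p`, and identification of weak limits. -/

section Integration

variable {α E : Type*} [MeasurableSpace α] {μ : Measure α} [NormedAddCommGroup E]

/-- Hölder's inequality on `s` gives the bound `C * μ s ^ (1/p - 1/q)`, which is uniform in `n` and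
has a positive exponent. -/
theorem unifIntegrable_of_eLpNorm_le {ι : Type*} {p q : ℝ≥0∞} (hp : p ≠ 0) (hpq : p < q)
    {f : ι → α → E} (hf : ∀ n, AEStronglyMeasurable (f n) μ) {C : ℝ≥0∞} (hC : C ≠ ⊤)
    (hfC : ∀ n, eLpNorm (f n) q μ ≤ C) : UnifIntegrable f p μ := by
  have hr : 0 < 1 / p.toReal - 1 / q.toReal := by
    have hp' : 0 < p.toReal := ENNReal.toReal_pos hp hpq.ne_top
    -- For `q = ⊤` the conventions `toReal ⊤ = 0` and `1 / 0 = 0` give the correct exponent `1/p`.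
    rcases eq_or_ne q ⊤ with rfl | hq
    · simpa using hp'
    · have : p.toReal < q.toReal := (ENNReal.toReal_lt_toReal hpq.ne_top hq).2 hpq
      have := one_div_lt_one_div_of_lt hp' this
      linarith
  set r := 1 / p.toReal - 1 / q.toReal
  have key : ∀ n s, MeasurableSet s → eLpNorm (s.indicator (f n)) p μ ≤ C * μ s ^ r := by
    intro n s hs
    rw [eLpNorm_indicator_eq_eLpNorm_restrict hs]
    calc _ ≤ eLpNorm (f n) q (μ.restrict s) * (μ.restrict s) univ ^ r :=
          eLpNorm_le_eLpNorm_mul_rpow_measure_univ hpq.le (hf n).restrict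
      _ ≤ C * μ s ^ r := by
          rw [Measure.restrict_apply_univ]
          gcongr
          exact (eLpNorm_mono_measure _ Measure.restrict_le_self).trans (hfC n)
  intro ε hε
  have ht : Tendsto (fun x : ℝ≥0∞ => C * x ^ r) (𝓝 0) (𝓝 0) := by
    have h1 : Tendsto (fun x : ℝ≥0∞ => x ^ r) (𝓝 0) (𝓝 0) := by
      have := (ENNReal.continuous_rpow_const (y := r)).tendsto 0
      rwa [ENNReal.zero_rpow_of_pos hr] at this
    simpa using ENNReal.Tendsto.const_mul h1 (Or.inr hC)
  have hev := ht.eventually (gt_mem_nhds (ENNReal.ofReal_pos.2 hε))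
  obtain ⟨δ, hδ, hδ'⟩ := ENNReal.nhds_zero_basis_Iic.eventually_iff.1 hev
  obtain ⟨δ', h1, h2⟩ : ∃ δ' : ℝ, 0 < δ' ∧ ENNReal.ofReal δ' ≤ δ := by
    refine ⟨(min δ 1).toReal, ENNReal.toReal_pos (by simp [hδ.ne']) (by simp), ?_⟩
    rw [ENNReal.ofReal_toReal (by simp)]
    exact min_le_left _ _
  exact ⟨δ', h1, fun n s hs hsd => (key n s hs).trans (hδ' (hsd.trans h2)).le⟩

/-- Bounded convergence in `L^p` on a finite measure space. -/
theorem tendsto_eLpNorm_sub_of_bounded [IsFiniteMeasure μ] {p : ℝ≥0∞} (hp : 1 ≤ p) (hp' : p ≠ ⊤)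
    {f : ℕ → α → E} {g : α → E} {C : ℝ} (hf : ∀ n, AEStronglyMeasurable (f n) μ)
    (hfC : ∀ n, ∀ᵐ x ∂μ, ‖f n x‖ ≤ C)
    (hfg : ∀ᵐ x ∂μ, Tendsto (fun n => f n x) atTop (𝓝 (g x))) :
    Tendsto (fun n => eLpNorm (f n - g) p μ) atTop (𝓝 0) := by
  have hgm : AEStronglyMeasurable g μ := aestronglyMeasurable_of_tendsto_ae atTop hf hfg
  have hg : MemLp g p μ := by
    refine MemLp.of_bound hgm C ?_
    filter_upwards [ae_all_iff.2 hfC, hfg] with x h1 h2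
    exact le_of_tendsto' h2.norm h1
  refine tendsto_Lp_finite_of_tendsto_ae hp hp' hf hg ?_ hfg
  refine unifIntegrable_of_eLpNorm_le (q := ⊤) (by positivity) (lt_top_iff_ne_top.2 hp') hf
    (C := ENNReal.ofReal C) ENNReal.ofReal_ne_top fun n => ?_
  exact eLpNormEssSup_le_of_ae_bound (hfC n)

/-- A sequence converging in norm in `L^p` converges almost everywhere along a subsequence. -/
theorem exists_subseq_tendsto_ae {p : ℝ≥0∞} (hp : p ≠ 0) {f : ℕ → α → E} {g : α → E}
    (hf : ∀ n, AEStronglyMeasurable (f n) μ) (hg : AEStronglyMeasurable g μ)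
    (h : Tendsto (fun n => eLpNorm (f n - g) p μ) atTop (𝓝 0)) :
    ∃ k : ℕ → ℕ, StrictMono k ∧ ∀ᵐ x ∂μ, Tendsto (fun n => f (k n) x) atTop (𝓝 (g x)) :=
  (tendstoInMeasure_of_tendsto_eLpNorm hp hf hg h).exists_seq_tendsto_ae

/-- Integration against a bounded weight is a bounded linear map on `L²`. -/
theorem exists_clm_integral_smul [NormedSpace ℝ E] [IsFiniteMeasure μ] {w : α → ℝ}
    (hw : AEStronglyMeasurable w μ) {C : ℝ} (hC : ∀ t, ‖w t‖ ≤ C) :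
    ∃ ℓ : Lp E 2 μ →L[ℝ] E, ∀ u, ℓ u = ∫ t, w t • u t ∂μ := by
  have hi : ∀ u : Lp E 2 μ, Integrable u μ := fun u => (Lp.memLp u).integrable (by norm_num)
  have hwi : ∀ u : Lp E 2 μ, Integrable (fun t => w t • u t) μ :=
    fun u => (hi u).bdd_smul C hw (Eventually.of_forall hC)
  refine ⟨LinearMap.mkContinuous
    { toFun := fun u => ∫ t, w t • u t ∂μ
      map_add' := fun u v => by
        rw [← integral_add (hwi u) (hwi v)]
        refine integral_congr_ae ?_
        filter_upwards [Lp.coeFn_add u v] with t ht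
        rw [ht, Pi.add_apply, smul_add]
      map_smul' := fun c u => by
        rw [RingHom.id_apply, ← integral_smul]
        refine integral_congr_ae ?_
        filter_upwards [Lp.coeFn_smul c u] with t ht
        rw [ht, Pi.smul_apply, smul_comm] }
    (C * (μ univ ^ (1 / (1 : ℝ≥0∞).toReal - 1 / (2 : ℝ≥0∞).toReal)).toReal) fun u => ?_,
    fun u => rfl⟩
  -- The sign of `C` can be read off from `hC` only at an actual point.
  rcases isEmpty_or_nonempty α with hα | ⟨⟨t₀⟩⟩
  · have h0 : u = 0 := by
      refine Lp.ext (Eventually.of_forall fun t => hα.elim t)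
    simp [h0, μ.eq_zero_of_isEmpty]
  have hC0 : 0 ≤ C := (norm_nonneg _).trans (hC t₀)
  have b1 : ‖∫ t, w t • u t ∂μ‖ ≤ ∫ t, C * ‖u t‖ ∂μ := by
    refine (norm_integral_le_integral_norm _).trans
      (integral_mono (hwi u).norm ((hi u).norm.const_mul _) fun t => ?_)
    rw [norm_smul]
    exact mul_le_mul_of_nonneg_right (hC t) (norm_nonneg _)
  have b2 : ∫ t, ‖u t‖ ∂μ ≤
      ‖u‖ * (μ univ ^ (1 / (1 : ℝ≥0∞).toReal - 1 / (2 : ℝ≥0∞).toReal)).toReal := by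
    rw [integral_norm_eq_lintegral_enorm (hi u).1, Lp.norm_def, ← ENNReal.toReal_mul,
      ← eLpNorm_one_eq_lintegral_enorm]
    refine ENNReal.toReal_mono (ENNReal.mul_ne_top (Lp.eLpNorm_ne_top u) ?_)
      (eLpNorm_le_eLpNorm_mul_rpow_measure_univ (by norm_num) (hi u).1)
    exact ENNReal.rpow_ne_top_of_nonneg (by norm_num) (measure_ne_top _ _)
  calc ‖∫ t, w t • u t ∂μ‖ ≤ C * ∫ t, ‖u t‖ ∂μ := by rwa [← integral_const_mul]
    _ ≤ _ := by
        rw [mul_assoc, mul_comm _ ‖u‖]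
        gcongr

/-- If `f n` is bounded in `L²`, converges weakly in `L²` to `g`, and converges weakly to `h`
pointwise almost everywhere, then `g = h`. -/
theorem WeakConv.ae_eq_of_ae_weakConv [NormedSpace ℝ E] [CompleteSpace E] [IsFiniteMeasure μ]
    {f : ℕ → Lp E 2 μ} {g : Lp E 2 μ} (hfg : WeakConv f g) {h : α → E} (hh : MemLp h 2 μ)
    (hae : ∀ᵐ t ∂μ, WeakConv (fun n => f n t) (h t)) : g =ᵐ[μ] h := by
  have hi : ∀ u : Lp E 2 μ, Integrable u μ := fun u => (Lp.memLp u).integrable (by norm_num)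
  refine Integrable.ae_eq_of_forall_setIntegral_eq _ _ (hi g) (hh.integrable (by norm_num))
    fun s hs _ => ?_
  refine (SeparatingDual.eq_iff_forall_dual_eq (R := ℝ)).2 fun φ => ?_
  rw [← φ.integral_comp_comm (hi g).integrableOn,
    ← φ.integral_comp_comm (hh.integrable (by norm_num)).integrableOn]
  obtain ⟨C, -, hC⟩ := hfg.bounded
  -- convergence of the integrals to the integral of the weak limit
  have t1 : Tendsto (fun n => ∫ t in s, φ (f n t) ∂μ) atTop (𝓝 (∫ t in s, φ (g t) ∂μ)) := by
    obtain ⟨ℓ, hℓ⟩ := exists_clm_integral_smul (E := E) (μ := μ) (w := s.indicator fun _ => (1 : ℝ))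
      (aestronglyMeasurable_const.indicator hs) (C := 1) fun t => by
        by_cases ht : t ∈ s <;> simp [ht]
    have hs' : ∀ u : Lp E 2 μ, φ (ℓ u) = ∫ t in s, φ (u t) ∂μ := by
      intro u
      rw [hℓ, φ.integral_comp_comm (hi u).integrableOn, ← integral_indicator hs]
      congr 2 with t
      by_cases ht : t ∈ s <;> simp [ht]
    simpa only [ContinuousLinearMap.comp_apply, hs'] using hfg (φ.comp ℓ)
  -- convergence of the integrals to the integral of the pointwise limit
  have t2 : Tendsto (fun n => ∫ t in s, φ (f n t) ∂μ) atTop (𝓝 (∫ t in s, φ (h t) ∂μ)) := by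
    have hm : ∀ n, AEStronglyMeasurable (fun t => φ (f n t)) μ :=
      fun n => φ.continuous.comp_aestronglyMeasurable (hi (f n)).1
    have hL : Tendsto (fun n => eLpNorm ((fun t => φ (f n t)) - fun t => φ (h t)) 1 μ)
        atTop (𝓝 0) := by
      refine tendsto_Lp_finite_of_tendsto_ae le_rfl (by norm_num) hm
        (memLp_one_iff_integrable.2 (φ.integrable_comp (hh.integrable (by norm_num)))) ?_ ?_
      -- A bound in `L²` gives uniform integrability in `L¹`, so Vitali's theorem applies without a
      -- dominating function.
      · refine unifIntegrable_of_eLpNorm_le (q := 2) (by norm_num) (by norm_num) hm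
          (C := ENNReal.ofReal (‖φ‖ * C)) ENNReal.ofReal_ne_top fun n => ?_
        refine (eLpNorm_le_mul_eLpNorm_of_ae_le_mul (g := f n) (c := ‖φ‖)
          (Eventually.of_forall fun t => φ.le_opNorm _) 2).trans ?_
        rw [ENNReal.ofReal_mul (norm_nonneg _)]
        gcongr
        rw [← Lp.enorm_def, ← ofReal_norm]
        exact ENNReal.ofReal_le_ofReal (hC n)
      · filter_upwards [hae] with t ht
        exact ht φ
    exact tendsto_setIntegral_of_L1' _ (φ.integrable_comp (hh.integrable (by norm_num))).1
      (Eventually.of_forall fun n => φ.integrable_comp (hi (f n))) hL s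
  exact tendsto_nhds_unique t1 t2

end Integration

/-! ### Pointwise bounds, pointwise weak convergence and compactness for states. -/

namespace Setting

variable {d : ℕ} {Ω : Set (EuclideanSpace ℝ (Fin d))} {T : ℝ} {p : ℝ≥0∞} [Fact (1 ≤ p)]
  {X U₀ H V Vt W Y : Type*}
  [NormedAddCommGroup X] [NormedSpace ℝ X] [NormedAddCommGroup U₀] [NormedSpace ℝ U₀]
  [NormedAddCommGroup H] [NormedSpace ℝ H] [NormedAddCommGroup V] [NormedSpace ℝ V]
  [NormedAddCommGroup Vt] [NormedSpace ℝ Vt] [NormedAddCommGroup W] [NormedSpace ℝ W]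
  [NormedAddCommGroup Y] [NormedSpace ℝ Y] (S : Setting Ω T p X U₀ H V Vt W Y)

theorem aestronglyMeasurable_val (u : S.𝒱) :
    AEStronglyMeasurable (S.val u) (timeMeasure T) :=
  Lp.aestronglyMeasurable _

theorem memLp_val (u : S.𝒱) : MemLp (S.val u) 2 (timeMeasure T) :=
  Lp.memLp _

theorem eLpNorm_val_le (u : S.𝒱) :
    eLpNorm (S.val u) 2 (timeMeasure T) ≤ ENNReal.ofReal ‖u‖ := by
  change eLpNorm (u.1.fst) 2 (timeMeasure T) ≤ ENNReal.ofReal ‖u.1‖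
  rw [← Lp.enorm_def, ← ofReal_norm]
  exact ENNReal.ofReal_le_ofReal (WithLp.norm_fst_le _ _)

theorem ae_iVH_val_eq (u : S.𝒱) : ∀ᵐ t ∂(timeMeasure T), ∃ ht : t ∈ Icc (0 : ℝ) T,
    S.iVH (S.val u t) = S.embC u ⟨t, ht⟩ := by
  filter_upwards [S.embC_spec u, ae_restrict_mem measurableSet_Ioo] with t h1 h2
  exact ⟨Ioo_subset_Icc_self h2, (h1 _).symm⟩

theorem ae_norm_iVH_val_le (u : S.𝒱) :
    ∀ᵐ t ∂(timeMeasure T), ‖S.iVH (S.val u t)‖ ≤ ‖S.embC‖ * ‖u‖ := by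
  filter_upwards [S.ae_iVH_val_eq u] with t ⟨ht, h⟩
  rw [h]
  exact ((S.embC u).norm_coe_le_norm _).trans (S.embC.le_opNorm u)

variable {S}

/-- Evaluation at `t` after `embC` is bounded and linear, hence preserves weak convergence. Only
countably many states occur, so one null set serves for all of them. -/
theorem ae_weakConv_iVH_val {u : ℕ → S.𝒱} {u' : S.𝒱} (h : WeakConv u u') :
    ∀ᵐ t ∂(timeMeasure T),
      WeakConv (fun n => S.iVH (S.val (u n) t)) (S.iVH (S.val u' t)) := by
  filter_upwards [ae_all_iff.2 fun n => S.ae_iVH_val_eq (u n), S.ae_iVH_val_eq u']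
    with t h1 ⟨ht, h2⟩
  have := h.map ((ContinuousMap.evalCLM ℝ (⟨t, ht⟩ : Icc (0 : ℝ) T)).comp S.embC)
  convert this using 1
  · ext n
    exact (h1 n).choose_spec
  · exact h2

/-- A compact operator on `V`, compatible with the inclusion `V ⊆ H`, maps weakly convergent
sequences of states to sequences that converge in norm in `L²(0,T;Z)`. -/
theorem tendsto_eLpNorm_of_compact {Z G : Type*} [NormedAddCommGroup Z] [NormedSpace ℝ Z]
    [NormedAddCommGroup G] [NormedSpace ℝ G] {K : V →L[ℝ] Z} (hK : IsCompactOperator K)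
    {i : Z →L[ℝ] G} (hi : Function.Injective i) {r : H →L[ℝ] G}
    (hr : ∀ v, i (K v) = r (S.iVH v)) {u : ℕ → S.𝒱} {u' : S.𝒱} (h : WeakConv u u') :
    Tendsto (fun n => eLpNorm ((fun t => K (S.val (u n) t)) - fun t => K (S.val u' t)) 2
      (timeMeasure T)) atTop (𝓝 0) := by
  obtain ⟨C, hC0, hC⟩ := h.bounded
  set D := C + ‖u'‖ + 1
  have hD : 0 < D := by positivity
  have hwD : ∀ n, eLpNorm (S.val (u n) - S.val u') 2 (timeMeasure T) ≤ ENNReal.ofReal D := by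
    intro n
    refine (eLpNorm_sub_le (S.aestronglyMeasurable_val _) (S.aestronglyMeasurable_val _)
      (by norm_num)).trans ?_
    refine (add_le_add (S.eLpNorm_val_le _) (S.eLpNorm_val_le _)).trans ?_
    rw [← ENNReal.ofReal_add (norm_nonneg _) (norm_nonneg _)]
    exact ENNReal.ofReal_le_ofReal (by linarith [hC n])
  rw [ENNReal.tendsto_nhds_zero]
  intro ε hε
  obtain ⟨e, he, heε⟩ : ∃ e : ℝ, 0 < e ∧ ENNReal.ofReal e ≤ ε := by
    refine ⟨(min ε 1).toReal, ENNReal.toReal_pos (by simp [hε.ne']) (by simp), ?_⟩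
    rw [ENNReal.ofReal_toReal (by simp)]
    exact min_le_left _ _
  -- As `D` bounds the differences in `L²(0,T;V)`, the choice `e / 2 / D` makes the first Ehrling
  -- term at most `e / 2`.
  obtain ⟨s, hs⟩ := hK.exists_norm_le_add_sum i hi (ε := e / 2 / D) (by positivity)
  set ψ : ℕ → ℝ → ℝ := fun n t => ‖K‖ * ∑ φ ∈ s, |φ (r (S.iVH (S.val (u n) t - S.val u' t)))|
  have hψm : ∀ n, AEStronglyMeasurable (ψ n) (timeMeasure T) := by
    intro n
    have hc : Continuous fun v : V => ‖K‖ * ∑ φ ∈ s, |φ (r (S.iVH v))| := by fun_prop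
    exact hc.comp_aestronglyMeasurable
      ((S.aestronglyMeasurable_val (u n)).sub (S.aestronglyMeasurable_val u'))
  -- The functionals are bounded in `t` and `n` by the embedding into `C([0,T];H)` and tend to zero
  -- at a.e. `t` by weak convergence in `H`.
  have hψ : Tendsto (fun n => eLpNorm (ψ n - fun _ => 0) 2 (timeMeasure T)) atTop (𝓝 0) := by
    refine tendsto_eLpNorm_sub_of_bounded (by norm_num) (by norm_num) hψm
      (C := ‖K‖ * ∑ φ ∈ s, ‖φ‖ * (‖r‖ * (‖S.embC‖ * C + ‖S.embC‖ * ‖u'‖))) ?_ ?_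
    · intro n
      filter_upwards [S.ae_norm_iVH_val_le (u n), S.ae_norm_iVH_val_le u'] with t h1 h2
      have h3 : ‖S.iVH (S.val (u n) t - S.val u' t)‖ ≤ ‖S.embC‖ * C + ‖S.embC‖ * ‖u'‖ := by
        rw [map_sub]
        refine (norm_sub_le _ _).trans (add_le_add (h1.trans ?_) h2)
        exact mul_le_mul_of_nonneg_left (hC n) S.embC.opNorm_nonneg
      rw [Real.norm_of_nonneg (by positivity)]
      refine mul_le_mul_of_nonneg_left (Finset.sum_le_sum fun φ _ => ?_) (norm_nonneg _)
      exact (φ.le_opNorm _).trans (mul_le_mul_of_nonneg_left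
        ((r.le_opNorm _).trans (mul_le_mul_of_nonneg_left h3 (norm_nonneg _))) (norm_nonneg _))
    · filter_upwards [ae_weakConv_iVH_val h] with t ht
      have h1 : Tendsto (fun n => ‖K‖ * ∑ φ ∈ s,
          |φ (r (S.iVH (S.val (u n) t))) - φ (r (S.iVH (S.val u' t)))|) atTop
          (𝓝 (‖K‖ * ∑ φ ∈ s, |φ (r (S.iVH (S.val u' t))) - φ (r (S.iVH (S.val u' t)))|)) :=
        (tendsto_finsetSum _ fun φ _ => ((ht (φ.comp r)).sub_const _).abs).const_mul _
      simpa [ψ, map_sub] using h1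
  filter_upwards [ENNReal.tendsto_nhds_zero.1 hψ (ENNReal.ofReal (e / 2))
    (by simpa using he)] with n hn
  have hb : eLpNorm ((fun t => K (S.val (u n) t)) - fun t => K (S.val u' t)) 2 (timeMeasure T) ≤
      eLpNorm ((fun t => (e / 2 / D) * ‖(S.val (u n) - S.val u') t‖) + ψ n) 2 (timeMeasure T) := by
    refine eLpNorm_mono_real fun t => ?_
    have := hs (S.val (u n) t - S.val u' t)
    simp only [hr] at this
    simpa [ψ, map_sub] using this
  refine (hb.trans ?_).trans heε
  refine (eLpNorm_add_le ?_ (hψm n) (by norm_num)).trans ?_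
  · exact ((S.aestronglyMeasurable_val (u n)).sub
      (S.aestronglyMeasurable_val u')).norm.const_mul _
  have h1 : eLpNorm (fun t => (e / 2 / D) * ‖(S.val (u n) - S.val u') t‖) 2 (timeMeasure T) ≤
      ENNReal.ofReal (e / 2) := by
    refine (eLpNorm_le_mul_eLpNorm_of_ae_le_mul (g := S.val (u n) - S.val u') (c := e / 2 / D)
      (Eventually.of_forall fun t => ?_) 2).trans ?_
    · rw [Real.norm_of_nonneg (by positivity)]
    · refine (mul_le_mul_right (hwD n) _).trans ?_
      rw [← ENNReal.ofReal_mul (by positivity)]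
      exact ENNReal.ofReal_le_ofReal (by rw [div_mul_cancel₀ _ hD.ne'])
  have h2 : eLpNorm (ψ n) 2 (timeMeasure T) ≤ ENNReal.ofReal (e / 2) := by
    have e1 : (ψ n - fun _ => 0) = ψ n := by ext; simp
    rwa [e1] at hn
  refine (add_le_add h1 h2).trans ?_
  rw [← ENNReal.ofReal_add (by positivity) (by positivity), add_halves]

end Setting

/-! ### Carathéodory measurability, truncation, continuity of the network. -/

/-- A Carathéodory function composed with a measurable function is measurable. -/
theorem aestronglyMeasurable_of_caratheodory {α V W : Type*} [MeasurableSpace α] {μ : Measure α}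
    [NormedAddCommGroup V] [NormedAddCommGroup W] {f : α → V → W}
    (hf : ∀ v, AEStronglyMeasurable (fun t => f t v) μ) (hc : ∀ᵐ t ∂μ, Continuous (f t))
    {u : α → V} (hu : AEStronglyMeasurable u μ) : AEStronglyMeasurable (fun t => f t (u t)) μ := by
  have simple : ∀ s : SimpleFunc α V, AEStronglyMeasurable (fun t => f t (s t)) μ := by
    intro s
    have e : (fun t => f t (s t)) =
        fun t => ∑ v ∈ s.range, (s ⁻¹' {v}).indicator (fun t => f t v) t := by
      ext t
      rw [Finset.sum_eq_single (s t)]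
      · simp
      · intro v _ hv
        exact indicator_of_notMem (by simpa using hv.symm) _
      · intro h
        exact absurd (s.mem_range_self t) h
    rw [e]
    exact Finset.aestronglyMeasurable_fun_sum _ fun v _ =>
      (hf v).indicator (s.measurableSet_fiber v)
  refine aestronglyMeasurable_of_tendsto_ae atTop
    (fun n => simple (hu.stronglyMeasurable_mk.approx n)) ?_
  filter_upwards [hc, hu.ae_eq_mk] with t h1 h2
  rw [h2]
  exact (h1.tendsto _).comp (hu.stronglyMeasurable_mk.tendsto_approx t)

/-- The truncation of a real number to the interval `[-C, C]`. -/
def truncate (C y : ℝ) : ℝ := max (-C) (min y C)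

theorem continuous_truncate (C : ℝ) : Continuous (truncate C) := by
  unfold truncate
  fun_prop

theorem truncate_of_abs_le {C y : ℝ} (h : |y| ≤ C) : truncate C y = y := by
  rw [abs_le] at h
  rw [truncate, min_eq_left h.2, max_eq_right h.1]

theorem truncate_mem {C : ℝ} (hC : 0 ≤ C) (y : ℝ) : truncate C y ∈ Icc (-C) C :=
  ⟨le_max_left _ _, max_le (by linarith) (min_le_right _ _)⟩

theorem continuous_netLayers {σ : ℝ → ℝ} (hσ : Continuous σ) {L : ℕ} {n : ℕ → ℕ} :
    ∀ (l : ℕ) (h : l ≤ L), Continuous fun q : NetParam L n × (Fin (n 0) → ℝ) =>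
      netLayers σ q.1 q.2 l h
  | 0, _ => continuous_snd
  | l + 1, h => by
    have ih := continuous_netLayers hσ (n := n) l (Nat.le_of_succ_le h)
    have hp : Continuous fun q : NetParam L n × (Fin (n 0) → ℝ) => q.1 ⟨l, h⟩ :=
      (continuous_apply _).comp continuous_fst
    have hz : Continuous fun q : NetParam L n × (Fin (n 0) → ℝ) =>
        (q.1 ⟨l, h⟩).1 (netLayers σ q.1 q.2 l (Nat.le_of_succ_le h)) + (q.1 ⟨l, h⟩).2 :=
      (hp.fst.clm_apply ih).add hp.snd
    refine continuous_pi fun i => ?_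
    by_cases hl : l + 1 = L
    · simp only [netLayers, hl, if_true]
      exact (continuous_apply i).comp hz
    · simp only [netLayers, hl, if_false]
      exact hσ.comp ((continuous_apply i).comp hz)

/-- Joint continuity is needed because `θ` and `α` vary along the sequence together with the state.
-/
theorem continuous_net {σ : ℝ → ℝ} (hσ : Continuous σ) {L m : ℕ} {n : ℕ → ℕ} (h0 : n 0 = m + 1)
    (hL : n L = 1) :
    Continuous fun q : (NetParam L n × (Fin m → ℝ)) × ℝ => net σ h0 hL q.1.1 q.1.2 q.2 := by
  have hi : Continuous fun q : (NetParam L n × (Fin m → ℝ)) × ℝ =>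
      fun i : Fin (n 0) => (Fin.snoc q.1.2 q.2 : Fin (m + 1) → ℝ) (Fin.cast h0 i) := by
    refine continuous_pi fun i => ?_
    have hs : Continuous fun q : (NetParam L n × (Fin m → ℝ)) × ℝ =>
        (Fin.snoc q.1.2 q.2 : Fin (m + 1) → ℝ) :=
      Continuous.finSnoc (A := fun _ => ℝ) (continuous_snd.comp continuous_fst) continuous_snd
    exact continuous_pi_iff.1 hs (Fin.cast h0 i)
  exact (continuous_apply _).comp
    ((continuous_netLayers hσ L le_rfl).comp ((continuous_fst.comp continuous_fst).prodMk hi))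

/-! ### Superposition operators on `L^p(Ω)`. -/

namespace Setting

section Superposition

variable {d : ℕ} {Ω : Set (EuclideanSpace ℝ (Fin d))} {p : ℝ≥0∞}

theorem superpose_congr {f g : ℝ → ℝ} {l : Lp ℝ p (volume.restrict Ω)}
    (h : (fun x => f (l x)) =ᵐ[volume.restrict Ω] fun x => g (l x)) :
    superpose Ω p f l = superpose Ω p g l := by
  unfold superpose
  by_cases hf : MemLp (fun x => f (l x)) p (volume.restrict Ω)
  · rw [dif_pos hf, dif_pos ((memLp_congr_ae h).1 hf), MemLp.toLp_eq_toLp_iff]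
    exact h
  · rw [dif_neg hf, dif_neg fun hg => hf ((memLp_congr_ae h).2 hg)]

variable [IsFiniteMeasure (volume.restrict Ω)]

theorem memLp_superposition {f : ℝ → ℝ} (hf : Continuous f) {C : ℝ} (hC : ∀ y, |f y| ≤ C)
    (l : Lp ℝ p (volume.restrict Ω)) : MemLp (fun x => f (l x)) p (volume.restrict Ω) :=
  MemLp.of_bound (hf.comp_aestronglyMeasurable (Lp.aestronglyMeasurable l)) C
    (Eventually.of_forall fun _ => hC _)

theorem coeFn_superpose {f : ℝ → ℝ} (hf : Continuous f) {C : ℝ} (hC : ∀ y, |f y| ≤ C)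
    (l : Lp ℝ p (volume.restrict Ω)) :
    superpose Ω p f l =ᵐ[volume.restrict Ω] fun x => f (l x) := by
  rw [superpose, dif_pos (memLp_superposition hf hC l)]
  exact MemLp.coeFn_toLp _

theorem norm_superpose_le [Fact (1 ≤ p)] {f : ℝ → ℝ} (hf : Continuous f) {C : ℝ} (hC0 : 0 ≤ C)
    (hC : ∀ y, |f y| ≤ C) (l : Lp ℝ p (volume.restrict Ω)) :
    ‖superpose Ω p f l‖ ≤ measureUnivNNReal (volume.restrict Ω) ^ p.toReal⁻¹ * C := by
  refine Lp.norm_le_of_ae_bound hC0 ?_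
  filter_upwards [coeFn_superpose hf hC l] with x hx
  rw [hx]
  exact hC _

/-- Superposition operators of bounded functions are continuous on `L^p`, jointly in the function
and the argument. -/
theorem tendsto_superpose [Fact (1 ≤ p)] (hp : p ≠ ⊤) {f : ℕ → ℝ → ℝ} {g : ℝ → ℝ}
    (hf : ∀ n, Continuous (f n)) (hg : Continuous g) {C : ℝ} (hfC : ∀ n y, |f n y| ≤ C)
    (hgC : ∀ y, |g y| ≤ C)
    (hfg : ∀ (k : ℕ → ℕ) (y : ℕ → ℝ) (z : ℝ), Tendsto k atTop atTop → Tendsto y atTop (𝓝 z) →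
      Tendsto (fun n => f (k n) (y n)) atTop (𝓝 (g z)))
    {l : ℕ → Lp ℝ p (volume.restrict Ω)} {l' : Lp ℝ p (volume.restrict Ω)}
    (hl : Tendsto l atTop (𝓝 l')) :
    Tendsto (fun n => superpose Ω p (f n) (l n)) atTop (𝓝 (superpose Ω p g l')) := by
  have hp1 : 1 ≤ p := Fact.out
  -- Norm convergence of `l` gives a.e. convergence only along a further subsequence, which is why
  -- `hfg` allows an arbitrary reindexing.
  refine tendsto_of_subseq_tendsto fun k hk => ?_
  have h1 := (Lp.tendsto_Lp_iff_tendsto_eLpNorm' _ _).1 (hl.comp hk)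
  obtain ⟨k', hk', hae⟩ := exists_subseq_tendsto_ae (by positivity)
    (fun n => Lp.aestronglyMeasurable (l (k n))) (Lp.aestronglyMeasurable l') h1
  refine ⟨k', ?_⟩
  rw [Lp.tendsto_Lp_iff_tendsto_eLpNorm']
  refine tendsto_eLpNorm_sub_of_bounded hp1 hp (C := C)
    (fun n => Lp.aestronglyMeasurable _) (fun n => ?_) ?_
  · filter_upwards [coeFn_superpose (hf (k (k' n))) (hfC _) (l (k (k' n)))] with x hx
    rw [hx]
    exact hfC _ _
  · filter_upwards [hae, coeFn_superpose hg hgC l', ae_all_iff.2 fun n =>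
      coeFn_superpose (hf (k (k' n))) (hfC _) (l (k (k' n)))] with x h2 h3 h4
    simp only [h3, h4]
    exact hfg (fun n => k (k' n)) _ _ (hk.comp hk'.tendsto_atTop) h2

theorem continuous_superpose [Fact (1 ≤ p)] (hp : p ≠ ⊤) {f : ℝ → ℝ} (hf : Continuous f) {C : ℝ}
    (hC : ∀ y, |f y| ≤ C) : Continuous (superpose Ω p f) := by
  refine continuous_iff_seqContinuous.2 fun l l' hl => ?_
  exact tendsto_superpose hp (fun _ => hf) hf (fun _ => hC) hC
    (fun _ _ z _ hy => (hf.tendsto z).comp hy) hl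

end Superposition

/-! ### Well-definedness of the Nemytskii operators and continuity of the network operator. -/

variable {d : ℕ} {Ω : Set (EuclideanSpace ℝ (Fin d))} {T : ℝ} {p : ℝ≥0∞} [Fact (1 ≤ p)]
  {X U₀ H V Vt W Y : Type*}
  [NormedAddCommGroup X] [NormedSpace ℝ X] [NormedAddCommGroup U₀] [NormedSpace ℝ U₀]
  [NormedAddCommGroup H] [NormedSpace ℝ H] [NormedAddCommGroup V] [NormedSpace ℝ V]
  [NormedAddCommGroup Vt] [NormedSpace ℝ Vt] [NormedAddCommGroup W] [NormedSpace ℝ W]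
  [NormedAddCommGroup Y] [NormedSpace ℝ Y] (S : Setting Ω T p X U₀ H V Vt W Y)

theorem fWellDefined (lam : X) (u : S.𝒱) : S.FWellDefined lam u := by
  obtain ⟨B, γ, hB, hγ, hF⟩ := S.F_growth
  set c := ‖S.embC‖ * ‖u‖
  -- `B` may take negative values. By monotonicity its value at `‖u(t)‖_H ∈ [0, c]` lies between
  -- those at `0` and `c`, so the sum of their absolute values dominates.
  refine MemLp.of_le_mul (c := |B ‖lam‖ 0| + |B ‖lam‖ c|) (hγ.add (S.memLp_val u).norm)
    (aestronglyMeasurable_of_caratheodory (S.F_measurable lam) (S.F_continuous lam)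
      (S.aestronglyMeasurable_val u)) ?_
  filter_upwards [hF, S.ae_norm_iVH_val_le u] with t h1 h2
  have l1 := hB ‖lam‖ (norm_nonneg (S.iVH (S.val u t)))
  have l2 := hB ‖lam‖ h2
  have h3 : |B ‖lam‖ ‖S.iVH (S.val u t)‖| ≤ |B ‖lam‖ 0| + |B ‖lam‖ c| := by
    rw [abs_le]
    constructor
    · linarith [neg_abs_le (B ‖lam‖ 0), abs_nonneg (B ‖lam‖ c)]
    · linarith [le_abs_self (B ‖lam‖ c), abs_nonneg (B ‖lam‖ 0)]
  calc ‖S.F t lam (S.val u t)‖ ≤ |B ‖lam‖ ‖S.iVH (S.val u t)‖ * (γ t + ‖S.val u t‖)| :=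
        (h1 _ _).trans (le_abs_self _)
    _ ≤ _ := by
        rw [abs_mul]
        exact mul_le_mul_of_nonneg_right h3 (abs_nonneg _)

theorem coeFn_nemF (lam : X) (u : S.𝒱) :
    S.nemF (lam, u) =ᵐ[timeMeasure T] fun t => S.F t lam (S.val u t) := by
  rw [nemF, dif_pos (S.fWellDefined lam u)]
  exact MemLp.coeFn_toLp _

/-- The essential bound on the product `(0,T) × Ω` passes to a.e. slice by Fubini. -/
theorem ae_abs_iVL_val_le (u : S.𝒱) : ∀ᵐ t ∂(timeMeasure T), ∀ᵐ x ∂(volume.restrict Ω),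
    |S.iVL (S.val u t) x| ≤ ‖S.embLinfty‖ * ‖u‖ := by
  have h : ∀ᵐ z ∂((timeMeasure T).prod (volume.restrict Ω)),
      ‖S.embLinfty u z‖ ≤ ‖S.embLinfty‖ * ‖u‖ := by
    filter_upwards [ae_le_eLpNormEssSup (f := S.embLinfty u)
      (μ := (timeMeasure T).prod (volume.restrict Ω))] with z hz
    refine le_trans ?_ (S.embLinfty.le_opNorm u)
    rw [Lp.norm_def, eLpNorm_exponent_top]
    rw [← toReal_enorm]
    refine ENNReal.toReal_mono ?_ hz
    rw [← eLpNorm_exponent_top]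
    exact Lp.eLpNorm_ne_top _
  filter_upwards [Measure.ae_ae_of_ae_prod h, S.embLinfty_spec u] with t h1 h2
  filter_upwards [h1, h2] with x h3 h4
  rw [h4] at h3
  exact h3

theorem ae_superpose_eq_truncate (f : ℝ → ℝ) (u : S.𝒱) {C : ℝ}
    (hC : ‖S.embLinfty‖ * ‖u‖ ≤ C) : ∀ᵐ t ∂(timeMeasure T),
      superpose Ω p f (S.iVL (S.val u t)) =
        superpose Ω p (fun y => f (truncate C y)) (S.iVL (S.val u t)) := by
  filter_upwards [S.ae_abs_iVL_val_le u] with t ht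
  refine superpose_congr ?_
  filter_upwards [ht] with x hx
  rw [truncate_of_abs_le (hx.trans hC)]

theorem exists_bound_truncate {f : ℝ → ℝ} (hf : Continuous f) {C : ℝ} (hC : 0 ≤ C) :
    ∃ D, ∀ y, |f (truncate C y)| ≤ D := by
  obtain ⟨D, hD⟩ := isCompact_Icc.exists_bound_of_continuousOn (hf.continuousOn (s := Icc (-C) C))
  exact ⟨D, fun y => hD _ (truncate_mem hC y)⟩

variable [IsFiniteMeasure (volume.restrict Ω)]

/-- Truncating at the essential bound of `u` leaves `f(u)` unchanged a.e. and makes `f` bounded.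
Superposition is then continuous on `L^p(Ω)`, which supplies measurability in time. -/
theorem netWellDefined (hp : p ≠ ⊤) {f : ℝ → ℝ} (hf : Continuous f) (u : S.𝒱) :
    S.NetWellDefined f u := by
  have hC0 : 0 ≤ ‖S.embLinfty‖ * ‖u‖ := mul_nonneg S.embLinfty.opNorm_nonneg (norm_nonneg _)
  obtain ⟨D, hD⟩ := exists_bound_truncate hf hC0
  have hD0 : 0 ≤ D := (abs_nonneg _).trans (hD 0)
  have hc : Continuous fun y => f (truncate (‖S.embLinfty‖ * ‖u‖) y) :=
    hf.comp (continuous_truncate _)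
  constructor
  · filter_upwards [S.ae_abs_iVL_val_le u] with t ht
    refine (memLp_congr_ae ?_).1 (memLp_superposition hc hD (S.iVL (S.val u t)))
    filter_upwards [ht] with x hx
    rw [truncate_of_abs_le hx]
  · refine (memLp_congr_ae (S.ae_superpose_eq_truncate f u le_rfl)).2 ?_
    refine MemLp.of_bound ?_ _ (Eventually.of_forall fun t => norm_superpose_le hc hD0 hD _)
    exact ((continuous_superpose hp hc hD).comp S.iVL.continuous).comp_aestronglyMeasurable
      (S.aestronglyMeasurable_val u)

variable {σ : ℝ → ℝ} {L m : ℕ} {n : ℕ → ℕ}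

theorem continuous_net_right (hσ : Continuous σ) (h0 : n 0 = m + 1) (hL : n L = 1)
    (θ : NetParam L n) (α : Fin m → ℝ) : Continuous (net σ h0 hL θ α) :=
  (continuous_net hσ h0 hL).comp (Continuous.prodMk_right (θ, α))

theorem coeFn_nemN (hp : p ≠ ⊤) (hσ : Continuous σ) (h0 : n 0 = m + 1) (hL : n L = 1)
    (α : Fin m → ℝ) (u : S.𝒱) (θ : NetParam L n) :
    S.nemN σ h0 hL (α, u, θ) =ᵐ[timeMeasure T]
      fun t => S.iLW (superpose Ω p (net σ h0 hL θ α) (S.iVL (S.val u t))) := by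
  have hw := S.netWellDefined hp (continuous_net_right hσ h0 hL θ α) u
  rw [nemN, dif_pos hw]
  filter_upwards [S.iLW.coeFn_compLp (hw.2.toLp _), hw.2.coeFn_toLp] with t h1 h2
  rw [h1, h2]

theorem weakToStrongContinuous_nemN (hp : p ≠ ⊤) (hσ : Continuous σ) (h0 : n 0 = m + 1)
    (hL : n L = 1) : WeakToStrongContinuous (S.nemN σ h0 hL) := by
  rintro x ⟨α, u, θ⟩ hx
  have hα : Tendsto (fun k => (x k).1) atTop (𝓝 α) := hx.fst.tendsto_of_finiteDimensional
  have hu : WeakConv (fun k => (x k).2.1) u := hx.snd.fst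
  have hθ : Tendsto (fun k => (x k).2.2) atTop (𝓝 θ) := hx.snd.snd.tendsto_of_finiteDimensional
  have hq : Tendsto (fun k => ((x k).2.2, (x k).1)) atTop (𝓝 (θ, α)) := hθ.prodMk_nhds hα
  obtain ⟨C, hC0, hC⟩ := hu.bounded
  have hN : 0 ≤ ‖S.embLinfty‖ := S.embLinfty.opNorm_nonneg
  set R := ‖S.embLinfty‖ * (C + ‖u‖)
  have hR0 : 0 ≤ R := by positivity
  have hR : ∀ k, ‖S.embLinfty‖ * ‖(x k).2.1‖ ≤ R := fun k =>
    mul_le_mul_of_nonneg_left ((hC k).trans (by linarith [norm_nonneg u])) hN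
  have hRu : ‖S.embLinfty‖ * ‖u‖ ≤ R := mul_le_mul_of_nonneg_left (by linarith) hN
  -- A convergent sequence together with its limit is compact, so one `D` bounds all the networks
  -- involved on `[-R, R]`.
  obtain ⟨D, hD⟩ := (hq.isCompact_insert_range.prod
    (isCompact_Icc (a := -R) (b := R))).exists_bound_of_continuousOn
    (continuous_net hσ h0 hL).continuousOn
  set f : ℕ → ℝ → ℝ := fun k y => net σ h0 hL (x k).2.2 (x k).1 (truncate R y)
  set g : ℝ → ℝ := fun y => net σ h0 hL θ α (truncate R y)
  have hf : ∀ k, Continuous (f k) := fun k =>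
    (continuous_net_right hσ h0 hL _ _).comp (continuous_truncate R)
  have hg : Continuous g := (continuous_net_right hσ h0 hL _ _).comp (continuous_truncate R)
  have hfD : ∀ k y, |f k y| ≤ D := fun k y =>
    hD (((x k).2.2, (x k).1), truncate R y) ⟨Or.inr ⟨k, rfl⟩, truncate_mem hR0 y⟩
  have hgD : ∀ y, |g y| ≤ D := fun y =>
    hD ((θ, α), truncate R y) ⟨Or.inl rfl, truncate_mem hR0 y⟩
  have hD0 : 0 ≤ D := (abs_nonneg _).trans (hgD 0)
  have hfg : ∀ (k : ℕ → ℕ) (y : ℕ → ℝ) (z : ℝ), Tendsto k atTop atTop → Tendsto y atTop (𝓝 z) →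
      Tendsto (fun i => f (k i) (y i)) atTop (𝓝 (g z)) := by
    intro k y z hk hy
    exact ((continuous_net hσ h0 hL).tendsto ((θ, α), truncate R z)).comp
      ((hq.comp hk).prodMk_nhds (((continuous_truncate R).tendsto z).comp hy))
  -- Convergence in `L²(0,T;L^p(Ω))` yields norm convergence in `L^p(Ω)` at a.e. `t` along a
  -- subsequence. Superposition preserves it, and bounded convergence in `t` concludes.
  refine tendsto_of_subseq_tendsto fun k hk => ?_
  obtain ⟨k', hk', hae⟩ := exists_subseq_tendsto_ae (by norm_num)
    (fun i => S.iVL.continuous.comp_aestronglyMeasurable (S.aestronglyMeasurable_val _))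
    (S.iVL.continuous.comp_aestronglyMeasurable (S.aestronglyMeasurable_val u))
    (tendsto_eLpNorm_of_compact S.iVL_compact S.iLW_inj S.iVW_comm (hu.comp_tendsto hk))
  have hkk : Tendsto (fun i => k (k' i)) atTop atTop := hk.comp hk'.tendsto_atTop
  have hval : ∀ᵐ t ∂(timeMeasure T), ∀ i, S.nemN σ h0 hL (x (k (k' i))) t =
      S.iLW (superpose Ω p (f (k (k' i))) (S.iVL (S.val (x (k (k' i))).2.1 t))) := by
    refine ae_all_iff.2 fun i => ?_
    filter_upwards [S.coeFn_nemN hp hσ h0 hL (x (k (k' i))).1 (x (k (k' i))).2.1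
      (x (k (k' i))).2.2, S.ae_superpose_eq_truncate _ _ (hR (k (k' i)))] with t h1 h2
    exact h1.trans (congrArg S.iLW h2)
  refine ⟨k', ?_⟩
  rw [Lp.tendsto_Lp_iff_tendsto_eLpNorm']
  refine tendsto_eLpNorm_sub_of_bounded (by norm_num) (by norm_num)
    (C := ‖S.iLW‖ * (measureUnivNNReal (volume.restrict Ω) ^ p.toReal⁻¹ * D))
    (fun i => Lp.aestronglyMeasurable _) (fun i => ?_) ?_
  · filter_upwards [hval] with t ht
    rw [ht i]
    exact (S.iLW.le_opNorm _).trans (mul_le_mul_of_nonneg_left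
      (norm_superpose_le (hf _) hD0 (hfD _) _) (norm_nonneg _))
  · filter_upwards [hval, hae, S.coeFn_nemN hp hσ h0 hL α u θ,
      S.ae_superpose_eq_truncate (net σ h0 hL θ α) u hRu] with t h1 h2 h3 h4
    simp only [h1, h3, h4]
    refine (S.iLW.continuous.tendsto _).comp ?_
    exact tendsto_superpose hp (fun i => hf (k (k' i))) hg (fun i => hfD _) hgD
      (fun j y z hj hy => hfg (fun i => k (k' (j i))) y z (hkk.comp hj) hy) h2

end Setting

/-! ### Closedness of `L²(0,T;V) ∩ H¹(0,T;Z)` and uniqueness of the weak derivative. -/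

section SobolevBochner

variable {V Z : Type*} [NormedAddCommGroup V] [NormedSpace ℝ V] [NormedAddCommGroup Z]
  [NormedSpace ℝ Z] {T : ℝ} {ι : V →L[ℝ] Z}

/-- For each test function the defining identity equates two continuous maps of `(u, u̇)`.
Closedness gives both completeness of `𝒱` and the closed graph of the time derivative. -/
theorem isClosed_sobolevBochner : IsClosed (sobolevBochner T ι :
    Set (WithLp 2 (Lp V 2 (timeMeasure T) × Lp Z 2 (timeMeasure T)))) := by
  have e : (sobolevBochner T ι : Set (WithLp 2 (Lp V 2 (timeMeasure T) × Lp Z 2 (timeMeasure T)))) =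
      ⋂ (φ : ℝ → ℝ) (_ : ContDiff ℝ ∞ φ) (_ : HasCompactSupport φ) (_ : tsupport φ ⊆ Ioo 0 T),
        {u | ∫ t in Ioo 0 T, deriv φ t • ι (u.fst t) = - ∫ t in Ioo 0 T, φ t • u.snd t} := by
    ext u
    simp only [mem_iInter]
    rfl
  rw [e]
  refine isClosed_iInter fun φ => isClosed_iInter fun h1 => isClosed_iInter fun h2 =>
    isClosed_iInter fun _ => ?_
  have hd : Continuous (deriv φ) := h1.continuous_deriv (by simp)
  obtain ⟨C, hC⟩ := h1.continuous.bounded_above_of_compact_support h2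
  obtain ⟨C', hC'⟩ := hd.bounded_above_of_compact_support h2.deriv
  obtain ⟨ℓ, hℓ⟩ := exists_clm_integral_smul (E := Z) (μ := timeMeasure T)
    h1.continuous.aestronglyMeasurable hC
  obtain ⟨ℓ', hℓ'⟩ := exists_clm_integral_smul (E := Z) (μ := timeMeasure T)
    hd.aestronglyMeasurable hC'
  have e2 : {u : WithLp 2 (Lp V 2 (timeMeasure T) × Lp Z 2 (timeMeasure T)) |
      ∫ t in Ioo 0 T, deriv φ t • ι (u.fst t) = - ∫ t in Ioo 0 T, φ t • u.snd t} =
      {u | ℓ' (ι.compLpL 2 (timeMeasure T) u.fst) = - ℓ u.snd} := by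
    ext u
    have e3 : ℓ' (ι.compLpL 2 (timeMeasure T) u.fst) =
        ∫ t in Ioo 0 T, deriv φ t • ι (u.fst t) := by
      rw [hℓ']
      refine integral_congr_ae ?_
      filter_upwards [ι.coeFn_compLpL u.fst] with t ht
      rw [ht]
    rw [mem_ofPred_eq, mem_ofPred_eq, e3, hℓ]
  rw [e2]
  have c1 := (WithLp.prodContinuousLinearEquiv 2 ℝ (Lp V 2 (timeMeasure T))
    (Lp Z 2 (timeMeasure T))).continuous
  exact isClosed_eq (ℓ'.continuous.comp ((ι.compLpL 2 (timeMeasure T)).continuous.comp c1.fst))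
    (ℓ.continuous.comp c1.snd).neg

/-- This is the fundamental lemma of the calculus of variations. -/
theorem snd_eq_zero_of_mem_sobolevBochner [CompleteSpace Z]
    {u : WithLp 2 (Lp V 2 (timeMeasure T) × Lp Z 2 (timeMeasure T))}
    (hu : u ∈ sobolevBochner T ι) (h : u.fst = 0) : u.snd = 0 := by
  have hi : Integrable u.snd (timeMeasure T) := (Lp.memLp u.snd).integrable (by norm_num)
  have key := isOpen_Ioo.ae_eq_zero_of_integral_contDiff_smul_eq_zero (U := Ioo 0 T)
    (μ := timeMeasure T) (f := u.snd) (hi.locallyIntegrable.locallyIntegrableOn _)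
    (fun φ h1 h2 h3 => by
      have h4 := hu φ h1 h2 h3
      have h5 : ∀ᵐ t ∂(timeMeasure T), deriv φ t • ι (u.fst t) = 0 := by
        rw [h]
        filter_upwards [Lp.coeFn_zero V 2 (timeMeasure T)] with t ht
        rw [ht, Pi.zero_apply, map_zero, smul_zero]
      rw [integral_congr_ae h5, integral_zero] at h4
      exact neg_eq_zero.1 h4.symm)
  rw [Lp.eq_zero_iff_ae_eq_zero]
  filter_upwards [key, ae_restrict_mem measurableSet_Ioo] with t h1 h2
  exact h1 h2

theorem snd_eq_of_mem_sobolevBochner [CompleteSpace Z]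
    {u v : WithLp 2 (Lp V 2 (timeMeasure T) × Lp Z 2 (timeMeasure T))}
    (hu : u ∈ sobolevBochner T ι) (hv : v ∈ sobolevBochner T ι) (h : u.fst = v.fst) :
    u.snd = v.snd :=
  sub_eq_zero.1 <| snd_eq_zero_of_mem_sobolevBochner (u := u - v) (Submodule.sub_mem _ hu hv)
    (sub_eq_zero.2 h)

end SobolevBochner

/-! ### Boundedness of the time derivative and weak closedness of `𝒢`. -/

namespace Setting

variable {d : ℕ} {Ω : Set (EuclideanSpace ℝ (Fin d))} {T : ℝ} {p : ℝ≥0∞} [Fact (1 ≤ p)]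
  {X U₀ H V Vt W Y : Type*}
  [NormedAddCommGroup X] [NormedSpace ℝ X] [NormedAddCommGroup U₀] [NormedSpace ℝ U₀]
  [NormedAddCommGroup H] [NormedSpace ℝ H] [NormedAddCommGroup V] [NormedSpace ℝ V]
  [NormedAddCommGroup Vt] [NormedSpace ℝ Vt] [NormedAddCommGroup W] [NormedSpace ℝ W]
  [NormedAddCommGroup Y] [NormedSpace ℝ Y] {S : Setting Ω T p X U₀ H V Vt W Y}

/-- Viewing `(u, u̇)` in the space with target `W` reduces linearity and the closed graph to the
submodule structure, closedness and uniqueness. -/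
theorem toLp_timeDeriv_mem {u : S.𝒱} (h : S.DerivInW u) :
    WithLp.toLp 2 (u.1.fst, S.timeDeriv u) ∈ sobolevBochner T (S.iHW.comp S.iVH) := by
  rw [timeDeriv, dif_pos h]
  exact h.choose_spec

/-- If every state has a time derivative in `𝒲`, then the time derivative is a bounded linear map
by the closed graph theorem. -/
theorem exists_clm_timeDeriv [CompleteSpace V] [CompleteSpace Vt] [CompleteSpace W]
    (h : ∀ u, S.DerivInW u) :
    ∃ D : S.𝒱 →L[ℝ] Lp W 2 (timeMeasure T), ∀ u, D u = S.timeDeriv u := by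
  let D : S.𝒱 →ₗ[ℝ] Lp W 2 (timeMeasure T) :=
    { toFun := S.timeDeriv
      map_add' := fun u v => snd_eq_of_mem_sobolevBochner (toLp_timeDeriv_mem (h (u + v)))
        (Submodule.add_mem _ (toLp_timeDeriv_mem (h u)) (toLp_timeDeriv_mem (h v))) rfl
      map_smul' := fun c u => snd_eq_of_mem_sobolevBochner (toLp_timeDeriv_mem (h (c • u)))
        (Submodule.smul_mem _ c (toLp_timeDeriv_mem (h u))) rfl }
  have hc : CompleteSpace S.𝒱 := isClosed_sobolevBochner.completeSpace_coe
  have hD : Continuous D := by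
    refine D.continuous_of_seq_closed_graph fun u u' g hu hg => ?_
    have c1 := (WithLp.prodContinuousLinearEquiv 2 ℝ (Lp V 2 (timeMeasure T))
      (Lp Vt 2 (timeMeasure T))).continuous
    have c2 := (WithLp.prodContinuousLinearEquiv 2 ℝ (Lp V 2 (timeMeasure T))
      (Lp W 2 (timeMeasure T))).symm.continuous
    have hu1 : Tendsto (fun n => (u n).1.fst) atTop (𝓝 u'.1.fst) :=
      ((c1.fst.comp continuous_subtype_val).tendsto u').comp hu
    have hlim : Tendsto (fun n => WithLp.toLp 2 ((u n).1.fst, D (u n))) atTop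
        (𝓝 (WithLp.toLp 2 (u'.1.fst, g))) :=
      (c2.tendsto (u'.1.fst, g)).comp (hu1.prodMk_nhds hg)
    have hmem := (isClosed_sobolevBochner (ι := S.iHW.comp S.iVH)).mem_of_tendsto hlim
      (Eventually.of_forall fun n => toLp_timeDeriv_mem (h (u n)))
    exact snd_eq_of_mem_sobolevBochner hmem (toLp_timeDeriv_mem (h u')) rfl
  exact ⟨⟨D, hD⟩, fun _ => rfl⟩

theorem weaklyClosed_forward [CompleteSpace V] [CompleteSpace Vt] [CompleteSpace W]
    (hT : 0 < T) {σ : ℝ → ℝ} {L m : ℕ} {n : ℕ → ℕ} (h0 : n 0 = m + 1) (hL : n L = 1)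
    (hD : ∀ u, S.DerivInW u) (hN : WeakContinuous (S.nemN σ h0 hL)) (hF : WeaklyClosed S.nemF) :
    WeaklyClosed (S.forward hT σ h0 hL) := by
  rintro x ⟨lam, α, u₀, u, θ⟩ ⟨b₁, b₂, b₃⟩ hx hb
  obtain ⟨D, hD⟩ := exists_clm_timeDeriv hD
  have x₁ : WeakConv (fun k => (x k).1) lam := hx.fst
  have x₂ : WeakConv (fun k => (x k).2.1) α := hx.snd.fst
  have x₃ : WeakConv (fun k => (x k).2.2.1) u₀ := hx.snd.snd.fst
  have x₄ : WeakConv (fun k => (x k).2.2.2.1) u := hx.snd.snd.snd.fst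
  have x₅ : WeakConv (fun k => (x k).2.2.2.2) θ := hx.snd.snd.snd.snd
  have y₂ : WeakConv _ b₂ := hb.snd.fst
  have y₃ : WeakConv _ b₃ := hb.snd.snd
  have z₁ : S.timeDeriv u - S.nemF (lam, u) - S.nemN σ h0 hL (α, u, θ) = b₁ := by
    have y₁ : WeakConv (fun k => D (x k).2.2.2.1 - S.nemF ((x k).1, (x k).2.2.2.1) -
        S.nemN σ h0 hL ((x k).2.1, (x k).2.2.2.1, (x k).2.2.2.2)) b₁ := by
      simp only [hD]
      exact hb.fst
    -- Solving the first component for `F(λ, u)` leaves only weakly convergent terms, so weak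
    -- closedness of `F` identifies the limit.
    have h1 := ((x₄.map D).sub (hN _ _ (x₂.prodMk (x₄.prodMk x₅)))).sub y₁
    have h2 : WeakConv (fun k => S.nemF ((x k).1, (x k).2.2.2.1))
        (D u - S.nemN σ h0 hL (α, u, θ) - b₁) := by
      convert h1 using 1
      ext1 k
      abel
    rw [hF _ (lam, u) _ (x₁.prodMk x₄) h2, ← hD]
    abel
  have z₂ : S.trace0 hT u - S.iU₀H u₀ = b₂ :=
    ((x₄.map ((ContinuousMap.evalCLM ℝ (⟨0, le_rfl, hT.le⟩ : Icc (0 : ℝ) T)).comp S.embC)).sub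
      (x₃.map S.iU₀H)).unique y₂
  have z₃ : S.M u = b₃ := (x₄.map S.M).unique y₃
  exact Prod.ext z₁ (Prod.ext z₂ z₃)

end Setting

/-! ### Weak closedness of the Nemytskii operator of `F`. -/

namespace Setting

variable {d : ℕ} {Ω : Set (EuclideanSpace ℝ (Fin d))} {T : ℝ} {p : ℝ≥0∞} [Fact (1 ≤ p)]
  {X U₀ H V Vt W Y : Type*}
  [NormedAddCommGroup X] [NormedSpace ℝ X] [NormedAddCommGroup U₀] [NormedSpace ℝ U₀]
  [NormedAddCommGroup H] [NormedSpace ℝ H] [NormedAddCommGroup V] [NormedSpace ℝ V]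
  [NormedAddCommGroup Vt] [NormedSpace ℝ Vt] [NormedAddCommGroup W] [NormedSpace ℝ W]
  [NormedAddCommGroup Y] [NormedSpace ℝ Y] {S : Setting Ω T p X U₀ H V Vt W Y}

/-- `F` is weakly closed if its values converge weakly at almost every time along a
subsequence. -/
theorem weaklyClosed_nemF_of_ae [CompleteSpace W]
    (h : ∀ (lam : ℕ → X) (u : ℕ → S.𝒱) (lam' : X) (u' : S.𝒱) (g : Lp W 2 (timeMeasure T)),
      WeakConv lam lam' → WeakConv u u' → WeakConv (fun n => S.nemF (lam n, u n)) g →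
      ∃ k : ℕ → ℕ, StrictMono k ∧ ∀ᵐ t ∂(timeMeasure T),
        WeakConv (fun n => S.F t (lam (k n)) (S.val (u (k n)) t)) (S.F t lam' (S.val u' t))) :
    WeaklyClosed S.nemF := by
  rintro x ⟨lam, u⟩ g hx hg
  obtain ⟨k, hk, hae⟩ := h (fun n => (x n).1) (fun n => (x n).2) lam u g
    hx.fst hx.snd hg
  have key := (hg.comp_tendsto hk.tendsto_atTop).ae_eq_of_ae_weakConv (S.fWellDefined lam u) (by
    filter_upwards [hae, ae_all_iff.2 fun n => S.coeFn_nemF (x (k n)).1 (x (k n)).2] with t h1 h2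
    convert h1 using 1
    ext n
    exact h2 n)
  exact Lp.ext ((S.coeFn_nemF lam u).trans key.symm)

theorem weaklyClosed_nemF_of_weaklyContinuous [CompleteSpace W] (h : S.FWeaklyContinuous) :
    WeaklyClosed S.nemF := by
  obtain ⟨FH, hFH⟩ := h
  refine weaklyClosed_nemF_of_ae fun lam u lam' u' _ hlam hu _ => ⟨id, strictMono_id, ?_⟩
  filter_upwards [hFH, ae_weakConv_iVH_val hu] with t ⟨h1, h2⟩ h3
  simpa only [h1, id] using h2 _ _ (hlam.prodMk h3)

/-- If `d k → 0` and `limsup (d k + z (y k)) ≤ z y'` for all functionals `z`, then `y k ⇀ y'`. -/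
theorem weakConv_of_limsup_le {d : ℕ → ℝ} (hd : Tendsto d atTop (𝓝 0)) {y : ℕ → W} {y' : W}
    (h : ∀ z : StrongDual ℝ W,
      limsup (fun k => ((d k + z (y k) : ℝ) : EReal)) atTop ≤ ((z y' : ℝ) : EReal)) :
    WeakConv y y' := by
  have upper : ∀ (z : StrongDual ℝ W) (c : ℝ), z y' < c → ∀ᶠ k in atTop, z (y k) < c := by
    intro z c hc
    have h1 : ∀ᶠ k in atTop, ((d k + z (y k) : ℝ) : EReal) < (((z y' + c) / 2 : ℝ) : EReal) :=
      eventually_lt_of_limsup_lt ((h z).trans_lt (EReal.coe_lt_coe_iff.2 (by linarith)))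
    have h2 : ∀ᶠ k in atTop, (z y' - c) / 2 < d k := hd.eventually (lt_mem_nhds (by linarith))
    filter_upwards [h1, h2] with k h3 h4
    have := EReal.coe_lt_coe_iff.1 h3
    linarith
  intro z
  refine tendsto_order.2 ⟨fun c hc => ?_, fun c hc => upper z c hc⟩
  -- The lower bound for `z` is the upper bound for `-z`.
  filter_upwards [upper (-z) (-c) (by simpa using hc)] with k hk
  simpa using hk

/-- Strong convergence of states in `L²(0,T;H)` against values of `F` bounded in `L²(0,T;W)` makes
the pairings tend to zero in `L¹`, hence a.e. along a subsequence. The `liminf` condition then holds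
with equality. -/
theorem weaklyClosed_nemF_of_pseudomonotone [CompleteSpace W] (hc : IsCompactOperator S.iVH)
    {j : H →L[ℝ] StrongDual ℝ W} (h : S.NegFPseudomonotone j) : WeaklyClosed S.nemF := by
  refine weaklyClosed_nemF_of_ae fun lam u lam' u' g hlam hu hg => ?_
  obtain ⟨C, -, hC⟩ := hg.bounded
  set w : ℕ → ℝ → H := fun n => (fun t => S.iVH (S.val (u n) t)) - fun t => S.iVH (S.val u' t)
  have hw : Tendsto (fun n => eLpNorm (w n) 2 (timeMeasure T)) atTop (𝓝 0) :=
    tendsto_eLpNorm_of_compact hc (i := ContinuousLinearMap.id ℝ H) Function.injective_id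
      (r := ContinuousLinearMap.id ℝ H) (fun _ => rfl) hu
  have hwm : ∀ n, AEStronglyMeasurable (w n) (timeMeasure T) := fun n =>
    (S.iVH.continuous.comp_aestronglyMeasurable (S.aestronglyMeasurable_val (u n))).sub
      (S.iVH.continuous.comp_aestronglyMeasurable (S.aestronglyMeasurable_val u'))
  set e : ℕ → ℝ → ℝ := fun n t => j (w n t) (S.nemF (lam n, u n) t)
  have hem : ∀ n, AEStronglyMeasurable (e n) (timeMeasure T) := fun n =>
    j.aestronglyMeasurable_comp₂ (hwm n) (Lp.aestronglyMeasurable _)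
  have he : Tendsto (fun n => eLpNorm (e n - fun _ => 0) 1 (timeMeasure T)) atTop (𝓝 0) := by
    have hb : ∀ n, eLpNorm (e n - fun _ => 0) 1 (timeMeasure T) ≤
        ENNReal.ofReal (‖j‖ * C) * eLpNorm (w n) 2 (timeMeasure T) := by
      intro n
      have e0 : (e n - fun _ => 0) = e n := by ext; simp
      rw [e0]
      have hh := eLpNorm_le_eLpNorm_mul_eLpNorm_of_nnnorm (p := 2) (q := 2) (r := 1) (hwm n)
        (Lp.aestronglyMeasurable (S.nemF (lam n, u n))) (fun a b => j a b) ‖j‖₊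
        (Eventually.of_forall fun t => by
          exact_mod_cast (j.le_opNorm₂ (w n t) (S.nemF (lam n, u n) t)))
      refine hh.trans ?_
      have hF : eLpNorm (S.nemF (lam n, u n)) 2 (timeMeasure T) ≤ ENNReal.ofReal C := by
        rw [← Lp.enorm_def, ← ofReal_norm]
        exact ENNReal.ofReal_le_ofReal (hC n)
      have hj : (‖j‖₊ : ℝ≥0∞) = ENNReal.ofReal ‖j‖ := (ofReal_norm j).symm
      rw [ENNReal.ofReal_mul j.opNorm_nonneg, hj, mul_right_comm]
      gcongr
    refine tendsto_of_tendsto_of_tendsto_of_le_of_le tendsto_const_nhds ?_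
      (fun _ => bot_le) hb
    simpa using ENNReal.Tendsto.const_mul hw (Or.inr ENNReal.ofReal_ne_top)
  obtain ⟨k, hk, hae⟩ := exists_subseq_tendsto_ae one_ne_zero hem aestronglyMeasurable_const he
  refine ⟨k, hk, ?_⟩
  filter_upwards [h, hae, ae_weakConv_iVH_val hu,
    ae_all_iff.2 fun n => S.coeFn_nemF (lam n) (u n)] with t h1 h2 h3 h4
  have h5 : ∀ n, e n t =
      (j (S.iVH (S.val (u n) t)) - j (S.iVH (S.val u' t))) (S.F t (lam n) (S.val (u n) t)) := by
    intro n
    simp only [e, w, h4, Pi.sub_apply, map_sub]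
  simp only [h5] at h2
  have h6 := h1 (fun n => S.val (u (k n)) t) (S.val u' t) (fun n => lam (k n)) lam'
    ((h3.comp_tendsto hk.tendsto_atTop).prodMk (hlam.comp_tendsto hk.tendsto_atTop))
    (((continuous_coe_real_ereal.tendsto 0).comp h2).liminf_eq.ge)
  refine weakConv_of_limsup_le h2 fun z => ?_
  -- With `w = u'(t) - z` the tested pairing is the vanishing one plus `z` applied to the value of
  -- `F`, the form required by `weakConv_of_limsup_le`.
  have h7 := h6 (j (S.iVH (S.val u' t)) - z)
  have h8 : ∀ (a b : StrongDual ℝ W) (y : W), (a - (b - z)) y = (a - b) y + z y := by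
    intro a b y
    simp only [sub_apply]
    ring
  simpa only [h8, sub_self, zero_apply, zero_add] using h7

end Setting

/-! ### Assembly of the four claims. -/

theorem lemma3p1 {d : ℕ} (Ω : Set (EuclideanSpace ℝ (Fin d))) (hΩ : IsOpen Ω)
    (hΩb : Bornology.IsBounded Ω) (T : ℝ) (hT : 0 < T) (p : ℝ≥0∞) [Fact (1 ≤ p)] (hp : p ≠ ⊤)
    (X U₀ H V Vt W Y : Type*)
    [NormedAddCommGroup X] [NormedSpace ℝ X] [CompleteSpace X]
    [NormedAddCommGroup U₀] [NormedSpace ℝ U₀] [CompleteSpace U₀]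
    [NormedAddCommGroup H] [NormedSpace ℝ H] [CompleteSpace H]
    [NormedAddCommGroup V] [NormedSpace ℝ V] [CompleteSpace V]
    [NormedAddCommGroup Vt] [NormedSpace ℝ Vt] [CompleteSpace Vt]
    [NormedAddCommGroup W] [NormedSpace ℝ W] [CompleteSpace W]
    [NormedAddCommGroup Y] [NormedSpace ℝ Y] [CompleteSpace Y]
    [TopologicalSpace.SeparableSpace H] [TopologicalSpace.SeparableSpace V]
    [TopologicalSpace.SeparableSpace Vt] [TopologicalSpace.SeparableSpace W]
    [TopologicalSpace.SeparableSpace Y]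
    (hX : IsReflexive X) (hU₀ : IsReflexive U₀) (hH : IsReflexive H) (hV : IsReflexive V)
    (hVt : IsReflexive Vt) (hW : IsReflexive W) (hY : IsReflexive Y)
    (S : Setting Ω T p X U₀ H V Vt W Y)
    (σ : ℝ → ℝ) (hσ : Continuous σ)
    (L m : ℕ) (n : ℕ → ℕ) (h0 : n 0 = m + 1) (hL : n L = 1) :
    -- the Nemytskii operators are well defined
    ((∀ lam u, S.FWellDefined lam u) ∧
      (∀ (α : Fin m → ℝ) (u : S.𝒱) (θ : NetParam L n), S.NetWellDefined (net σ h0 hL θ α) u)) ∧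
    -- the network operator is weak-to-strong continuous, in particular weakly continuous
    (LocallyLipschitz σ →
      WeakToStrongContinuous (S.nemN σ h0 hL) ∧ WeakContinuous (S.nemN σ h0 hL)) ∧
    -- `F` is weakly closed
    ((S.FWeaklyContinuous ∨
        (IsCompactOperator S.iVH ∧
          ∃ j : H →L[ℝ] StrongDual ℝ W, Function.Injective j ∧ S.NegFPseudomonotone j)) →
      WeaklyClosed S.nemF) ∧
    -- `𝒢` is weakly closed; that `u̇ ∈ 𝒲` for all states is part of `𝒢` being defined
    ((∀ u, S.DerivInW u) → WeakContinuous (S.nemN σ h0 hL) → WeaklyClosed S.nemF →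
      WeaklyClosed (S.forward hT σ h0 hL)) := by
  have : IsFiniteMeasure (volume.restrict Ω) :=
    isFiniteMeasure_restrict.2 hΩb.measure_lt_top.ne
  refine ⟨⟨S.fWellDefined, fun α u θ => S.netWellDefined hp
    (Setting.continuous_net_right hσ h0 hL θ α) u⟩, fun _ => ?_, ?_,
    fun hD hN hF => Setting.weaklyClosed_forward hT h0 hL hD hN hF⟩
  · have h := S.weakToStrongContinuous_nemN hp hσ h0 hL
    exact ⟨h, h.weakContinuous⟩
  · rintro (h | ⟨hc, j, -, h⟩)
    · exact Setting.weaklyClosed_nemF_of_weaklyContinuous h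
    · exact Setting.weaklyClosed_nemF_of_pseudomonotone hc h
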